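/- Let $\widehat{\mathbb R}^3=\mathbb R^3\cup\{\infty\}$. A \emph{circle} is a Euclidean circle of positive radius or a straight line together with $\infty$; a \emph{circular arc} is a continuous injective map from $[0,1]$ to $\widehat{\mathbb R}^3$ with image in a circle. A \emph{Dupin cyclide} is the image under a Möbius transformation of $\widehat{\mathbb R}^3$ of a surface obtained by rotating a circle (or line) about an axis in its plane, the circle being different from the axis (so these are the Möbius images of tori, circular cylinders and circular cones; spheres and planes are included as degenerate cases). A \emph{Dupin cyclide patch} is a continuous map $f:[0,1]^2\to\widehat{\mathbb R}^3$ whose image lies on a Dupin cyclide but not on a single circle, such that for all $u,u',v,v'\in[0,1]$ the four points $f(u,v),f(u',v),f(u',v'),f(u,v')$ lie on a circle, and such that every parameter line $f(\cdot,v)$, $f(u,\cdot)$ is a circular arc or constant (the latter happens where the patch runs through a singular point). It is \emph{adapted} to a quadrilateral $x_{00},x_{10},x_{11},x_{01}$ if $f(i,j)=x_{ij}$ for $i,j\in\{0,1\}$. **Corollary.** Let $x_{00},x_{10},x_{11},x_{01}\in\mathbb R^3$ be four pairwise distinct points on a circle. Let $p_0,q_0:[0,1]\to\mathbb R^3$ be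 circular arcs with $p_0(i)=x_{i0}$ and $q_0(j)=x_{0j}$ for $i,j\in\{0,1\}$, which meet orthogonally at $x_{00}$, i.e. whose initial tangent directions there are orthogonal. Then there is exactly one Dupin cyclide patch $f$ that is adapted to the quadrilateral and satisfies $f(u,0)=p_0(u)$ and $f(0,v)=q_0(v)$ for all $u,v\in[0,1]$. -/

import Mathlib

open scoped Topology unitInterval OnePoint

noncomputable section

namespace Cyclidic

/-- Euclidean three-space. -/
abbrev E3 : Type := EuclideanSpace ℝ (Fin 3)

/-- The Moebius space: Euclidean three-space together with one point `∞`. -/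
abbrev M3 : Type := OnePoint E3

/-- Circles of Moebius geometry: Euclidean circles of positive radius (the intersection of a
sphere with a plane through its center), and straight lines completed by `∞`. -/
def IsCircle (S : Set M3) : Prop :=
  (∃ (s : EuclideanGeometry.Sphere E3) (P : AffineSubspace ℝ E3),
      0 < s.radius ∧ s.center ∈ P ∧ Module.finrank ℝ P.direction = 2 ∧
      S = ((↑) : E3 → M3) '' {x | x ∈ P ∧ x ∈ s}) ∨
  (∃ a b : E3, a ≠ b ∧ S = insert ∞ (((↑) : E3 → M3) '' {x | x ∈ line[ℝ, a, b]}))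

/-- The four points lie on a common circle. -/
def OnCommonCircle (a b c d : M3) : Prop :=
  ∃ S : Set M3, IsCircle S ∧ a ∈ S ∧ b ∈ S ∧ c ∈ S ∧ d ∈ S

/-- A parametrized circular arc: a continuous injective curve on a circle. -/
def IsCircularArc (γ : I → M3) : Prop :=
  Continuous γ ∧ Function.Injective γ ∧ ∃ S : Set M3, IsCircle S ∧ Set.range γ ⊆ S

/-- `t` is the unit tangent vector of the curve `γ` at its starting point, i.e. the limit of the
normalized chords issuing from there (no differentiability of the parametrization is needed). -/
def HasInitialDirection (γ : I → E3) (t : E3) : Prop :=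
  Filter.Tendsto (fun s : I => ‖γ s - γ 0‖⁻¹ • (γ s - γ 0)) (𝓝[≠] 0) (𝓝 t)

/-- Two curves with the same starting point meet orthogonally there. -/
def MeetOrthogonally (p q : I → E3) : Prop :=
  p 0 = q 0 ∧ ∃ s t : E3,
    HasInitialDirection p s ∧ HasInitialDirection q t ∧ inner ℝ s t = 0

open Classical in
/-- Inversion in the sphere with center `c` and radius `R`, as a map of the Moebius space. -/
def sphereInversion (c : E3) (R : ℝ) (x : M3) : M3 :=
  x.elim (c : M3) fun y => if y = c then ∞ else ((EuclideanGeometry.inversion c R y : E3) : M3)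

/-- Moebius transformations: finite compositions of sphere inversions and Euclidean isometries. -/
inductive IsMoebius : (M3 → M3) → Prop
  | id : IsMoebius id
  | inversion (c : E3) (R : ℝ) (hR : 0 < R) (g : M3 → M3) (hg : IsMoebius g) :
      IsMoebius (sphereInversion c R ∘ g)
  | isometry (φ : E3 ≃ᵢ E3) (g : M3 → M3) (hg : IsMoebius g) :
      IsMoebius (OnePoint.map φ ∘ g)

/-- Rotation by the angle `θ` about the third coordinate axis; it fixes `∞`. -/
def rotation (θ : ℝ) : M3 → M3 :=
  OnePoint.map fun x : E3 =>
    !₂[Real.cos θ * x 0 - Real.sin θ * x 1, Real.sin θ * x 0 + Real.cos θ * x 1, x 2]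

/-- The third coordinate axis, completed by `∞`. -/
def axis : Set M3 := insert ∞ (((↑) : E3 → M3) '' {x | x 0 = 0 ∧ x 1 = 0})

/-- The plane spanned by the first and the third coordinate axis, completed by `∞`. -/
def meridianPlane : Set M3 := insert ∞ (((↑) : E3 → M3) '' {x | x 1 = 0})

/-- Dupin cyclides: Moebius images of the surfaces that arise by rotating a circle (or line) `K`
about an axis in its plane, `K` not being the axis itself.  These surfaces are the tori
(ring, horn and spindle), the circular cylinders and the circular cones, and, as degenerate
cases, the spheres and planes. -/
def IsDupinCyclide (D : Set M3) : Prop :=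
  ∃ (g : M3 → M3) (K : Set M3), IsMoebius g ∧ IsCircle K ∧ K ⊆ meridianPlane ∧ K ≠ axis ∧
    D = g '' (⋃ θ : ℝ, rotation θ '' K)

/-- A Moebius translation surface patch: all parameter quadrilaterals are circular. -/
structure IsMoebiusTranslationPatch (f : I × I → M3) : Prop where
  continuous : Continuous f
  circular : ∀ u u' v v' : I, OnCommonCircle (f (u, v)) (f (u', v)) (f (u', v')) (f (u, v'))

/-- A Dupin cyclide patch: a Moebius translation surface patch on a Dupin cyclide all of whose
parameter lines (the curvature lines) are circular arcs.  As on spindle tori and cones, the patch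
may contain singular points of the cyclide; a parameter line may collapse to such a point.
The last field excludes maps whose image is a curve instead of a surface. -/
structure IsDupinCyclidePatch (f : I × I → M3) : Prop extends IsMoebiusTranslationPatch f where
  onCyclide : ∃ D : Set M3, IsDupinCyclide D ∧ Set.range f ⊆ D
  uLine : ∀ v : I, IsCircularArc (fun u => f (u, v)) ∨ ∃ s : M3, ∀ u : I, f (u, v) = s
  vLine : ∀ u : I, IsCircularArc (fun v => f (u, v)) ∨ ∃ s : M3, ∀ v : I, f (u, v) = s
  nondegenerate : ¬ ∃ S : Set M3, IsCircle S ∧ Set.range f ⊆ S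

/-- A circular quadrilateral: four pairwise distinct points on a common circle. -/
def IsCircularQuad (x00 x10 x11 x01 : E3) : Prop :=
  [x00, x10, x11, x01].Nodup ∧ OnCommonCircle (x00 : M3) x10 x11 x01

/-- The corners of the patch are the vertices of the quadrilateral. -/
def IsAdapted (f : I × I → M3) (x00 x10 x11 x01 : E3) : Prop :=
  f (0, 0) = x00 ∧ f (1, 0) = x10 ∧ f (1, 1) = x11 ∧ f (0, 1) = x01

end Cyclidic

end

/-!
Existence and uniqueness of the Dupin cyclide patch with two prescribed orthogonal boundary arcs
and a prescribed circular quadrilateral of corners.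

All notions involved are invariant under Moebius transformations. That these preserve circles is
read off from an equational description of circles as intersections of two orthogonal generalized
spheres (`isCircle_iff_isOrthogonalSphereInter`), on whose coefficients an inversion acts linearly.
After the inversion at `x₀₀` the corner `x₀₀` is `∞`, circles through it are lines, the arcs `p` and
`q` run on orthogonal lines, and every point `f(u, v)` lies on the line through `p(u)` and `q(v)`.

*Uniqueness.* Let `P = p(u)`, `P' = p(u')`, `Q = q(v)`. Concyclicity of `f(u, v)`, `f(u', v)`, `P`,
`P'` means that the power of `Q` with respect to their circle is the same along the secants `QP` and
`QP'`. Hence `f(u', v)` determines `f(u, v)` unless it coincides with `P` (`exists_eq_of_secant`).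
Since the parameter lines are arcs or constant, such coincidences occur only for finitely many
parameters (`finite_setOf_eq`), and continuity takes care of those. Starting from the corner `x₁₁`,
and after exchanging the arcs if `x₀₁` lies on the circle of `p`, this determines first the row
`v = 1`, then almost all columns, hence the patch (`IsDupinCyclidePatch.eq_of_boundary_eq`).

*Existence.* Let `a₁`, `a₂` be the feet of the common perpendicular of the two lines, and let the
corners be `P` on the first line, `Q` on the second, and `X = P + l (Q - P)`. If
`m = l ‖Q - P‖² - ‖P - a₁‖²` is positive, consider the circle with center `a₁` and radius `√m` in
the plane orthogonal to the first line. An inversion at one of its points makes it the axis of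
rotation, the first line an orbit of the rotations, and the second line a circle in a meridian
plane, while `X` becomes the image of `Q` under the rotation that takes `∞` to `P`. So rotating `q`
along `p` gives the patch (`hasPatch_rotation`, `hasPatch_of_pos`). Exchanging the two arcs replaces
`m` by `‖a₂ - a₁‖² - m`. If neither number is positive, both vanish, the lines meet, and `X` is the
foot of the perpendicular from their intersection to `PQ`; after an inversion at the intersection
the patch is a planar patch of rectangles (`hasPatch_addInfty`, `hasPatch_of_foot`).
-/

noncomputable section

namespace Cyclidic

open Filter EuclideanGeometry

/-! ### Circles as intersections of orthogonal spheres -/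

/-- The locus `α ‖x - c‖² + 2 ⟪β, x - c⟫ + γ = 0` in Moebius space: a generalized sphere, written
in coordinates centered at `c`. It contains `∞` exactly when `α = 0`. -/
def genSphere (c : E3) (α : ℝ) (β : E3) (γ : ℝ) : Set M3 :=
  {x | x.elim (α = 0) fun y => α * ‖y - c‖ ^ 2 + 2 * inner ℝ β (y - c) + γ = 0}

@[simp] theorem infty_mem_genSphere {c : E3} {α : ℝ} {β : E3} {γ : ℝ} :
    (∞ : M3) ∈ genSphere c α β γ ↔ α = 0 := Iff.rfl

@[simp] theorem coe_mem_genSphere {c : E3} {α : ℝ} {β : E3} {γ : ℝ} {y : E3} :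
    (y : M3) ∈ genSphere c α β γ ↔ α * ‖y - c‖ ^ 2 + 2 * inner ℝ β (y - c) + γ = 0 := Iff.rfl

/-- An equational description of circles: `S` is the intersection of two generalized spheres that
are real and orthogonal with respect to the Lorentz form `‖β‖² - α γ` of sphere geometry. -/
def IsOrthogonalSphereInter (c : E3) (S : Set M3) : Prop :=
  ∃ (α : ℝ) (β : E3) (γ α' : ℝ) (β' : E3) (γ' : ℝ),
    0 < ‖β‖ ^ 2 - α * γ ∧ 0 < ‖β'‖ ^ 2 - α' * γ' ∧ 2 * inner ℝ β β' = α * γ' + α' * γ ∧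
    S = genSphere c α β γ ∩ genSphere c α' β' γ'

theorem exists_orthonormalBasis_of_orthonormal {v : Fin 3 → E3} {s : Set (Fin 3)}
    (hv : Orthonormal ℝ (s.domRestrict v)) :
    ∃ b : OrthonormalBasis (Fin 3) ℝ E3, ∀ i ∈ s, b i = v i :=
  hv.exists_orthonormalBasis_extension_of_card_eq (by simp)

theorem exists_orthonormalBasis_of_unit {d : E3} (hd : ‖d‖ = 1) :
    ∃ b : OrthonormalBasis (Fin 3) ℝ E3, b 0 = d := by
  have hv : Orthonormal ℝ (({0} : Set (Fin 3)).domRestrict fun _ => d) := by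
    rw [orthonormal_iff_ite]
    rintro ⟨i, rfl⟩ ⟨j, rfl⟩
    simp [hd]
  obtain ⟨b, hb⟩ := exists_orthonormalBasis_of_orthonormal hv
  exact ⟨b, hb 0 rfl⟩

theorem exists_orthonormalBasis_of_orthogonal_units {d e : E3} (hd : ‖d‖ = 1) (he : ‖e‖ = 1)
    (hde : inner ℝ d e = 0) :
    ∃ b : OrthonormalBasis (Fin 3) ℝ E3, b 1 = d ∧ b 2 = e := by
  have hv : Orthonormal ℝ (({1, 2} : Set (Fin 3)).domRestrict ![d, d, e]) := by
    rw [orthonormal_iff_ite]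
    have hed : inner ℝ e d = 0 := by rw [real_inner_comm, hde]
    have hdd : inner ℝ d d = 1 := by rw [real_inner_self_eq_norm_sq, hd, one_pow]
    have hee : inner ℝ e e = 1 := by rw [real_inner_self_eq_norm_sq, he, one_pow]
    rintro ⟨i, hi⟩ ⟨j, hj⟩
    simp only [Set.mem_insert_iff, Set.mem_singleton_iff] at hi hj
    rcases hi with rfl | rfl <;> rcases hj with rfl | rfl
    · simpa using hdd
    · simpa using hde
    · simpa using hed
    · simpa using hee
  obtain ⟨b, hb⟩ := exists_orthonormalBasis_of_orthonormal hv
  exact ⟨b, by simpa using hb 1 (by simp), by simpa using hb 2 (by simp)⟩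

theorem orthonormalBasis_inner_eq_zero (b : OrthonormalBasis (Fin 3) ℝ E3) :
    (inner ℝ (b 0) (b 1) = 0 ∧ inner ℝ (b 0) (b 2) = 0 ∧ inner ℝ (b 1) (b 0) = 0) ∧
      inner ℝ (b 1) (b 2) = 0 ∧ inner ℝ (b 2) (b 0) = 0 ∧ inner ℝ (b 2) (b 1) = 0 :=
  have h := b.orthonormal.2
  ⟨⟨h (by decide), h (by decide), h (by decide)⟩, h (by decide), h (by decide), h (by decide)⟩

theorem orthonormalBasis_inner_self (b : OrthonormalBasis (Fin 3) ℝ E3) (i : Fin 3) :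
    inner ℝ (b i) (b i) = 1 := by
  rw [real_inner_self_eq_norm_sq, b.orthonormal.1, one_pow]

theorem eq_of_orthonormalBasis_inner_eq (b : OrthonormalBasis (Fin 3) ℝ E3) {x y : E3}
    (h0 : inner ℝ (b 0) x = inner ℝ (b 0) y) (h1 : inner ℝ (b 1) x = inner ℝ (b 1) y)
    (h2 : inner ℝ (b 2) x = inner ℝ (b 2) y) : x = y := by
  rw [← b.sum_repr' x, ← b.sum_repr' y]
  simp only [Fin.sum_univ_three, h0, h1, h2]

theorem mem_affineSpan_pair_iff {a b x : E3} :
    x ∈ line[ℝ, a, b] ↔ ∃ s : ℝ, x = a + s • (b - a) := by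
  rw [mem_affineSpan_pair_iff_exists_lineMap_eq]
  simp only [AffineMap.lineMap_apply, vsub_eq_sub, vadd_eq_add]
  constructor
  · rintro ⟨r, rfl⟩; exact ⟨r, add_comm _ _⟩
  · rintro ⟨r, rfl⟩; exact ⟨r, add_comm _ _⟩

theorem exists_normal_of_finrank_eq_two {P : AffineSubspace ℝ E3} {o : E3} (ho : o ∈ P)
    (hP : Module.finrank ℝ P.direction = 2) :
    ∃ n : E3, n ≠ 0 ∧ ∀ x, x ∈ P ↔ inner ℝ n (x - o) = 0 := by
  have h1 : Module.finrank ℝ P.directionᗮ = 1 := by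
    have := P.direction.finrank_add_finrank_orthogonal
    rw [hP, finrank_euclideanSpace_fin] at this
    omega
  obtain ⟨⟨n, hn⟩, hn0, -⟩ := finrank_eq_one_iff'.1 h1
  have hn0 : n ≠ 0 := fun h => hn0 (by simp [h])
  refine ⟨n, hn0, fun x => ?_⟩
  have hle : P.direction ≤ (Submodule.span ℝ {n})ᗮ := by
    intro y hy
    rw [Submodule.mem_orthogonal_singleton_iff_inner_left]
    exact Submodule.inner_right_of_mem_orthogonal hy hn
  have : Fact (Module.finrank ℝ E3 = 2 + 1) := ⟨by simp⟩
  have heq := Submodule.eq_of_le_of_finrank_eq hle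
    (by rw [hP, Submodule.finrank_orthogonal_span_singleton (n := 2) hn0])
  rw [← AffineSubspace.vsub_right_mem_direction_iff_mem ho, heq,
    Submodule.mem_orthogonal_singleton_iff_inner_right]
  rfl

theorem isOrthogonalSphereInter_of_isCircle (c : E3) {S : Set M3} (hS : IsCircle S) :
    IsOrthogonalSphereInter c S := by
  rcases hS with ⟨s, P, hr, ho, hP, rfl⟩ | ⟨a, b, hab, rfl⟩
  · obtain ⟨n, hn0, hn⟩ := exists_normal_of_finrank_eq_two ho hP
    have hn1 : 0 < ‖n‖ := norm_pos_iff.2 hn0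
    refine ⟨1, -(s.center - c), ‖s.center - c‖ ^ 2 - s.radius ^ 2, 0, n,
      -2 * inner ℝ n (s.center - c), ?_, ?_, ?_, ?_⟩
    · rw [norm_neg]; nlinarith
    · nlinarith
    · rw [inner_neg_left, real_inner_comm]; ring
    · ext x
      induction x using OnePoint.rec with
      | infty => simp
      | coe y =>
        have e : y - s.center = (y - c) - (s.center - c) := by abel
        have h1 : y ∈ s ↔ ‖y - s.center‖ ^ 2 = s.radius ^ 2 := by
          rw [EuclideanGeometry.mem_sphere, dist_eq_norm,
            sq_eq_sq₀ (norm_nonneg _) hr.le]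
        simp only [Set.mem_image, OnePoint.coe_eq_coe, exists_eq_right, Set.mem_ofPred_eq,
          Set.mem_inter_iff, coe_mem_genSphere, hn, h1]
        rw [e, norm_sub_sq_real, inner_sub_right, inner_neg_left,
          real_inner_comm (y - c) (s.center - c)]
        constructor
        · rintro ⟨h, h'⟩; constructor <;> linarith
        · rintro ⟨h, h'⟩; constructor <;> linarith
  · have hd : ‖b - a‖ ≠ 0 := norm_ne_zero_iff.2 (sub_ne_zero.2 hab.symm)
    obtain ⟨w, hw⟩ := exists_orthonormalBasis_of_unit (d := ‖b - a‖⁻¹ • (b - a))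
      (by rw [norm_smul, norm_inv, norm_norm, inv_mul_cancel₀ hd])
    have hwi := orthonormalBasis_inner_self w
    obtain ⟨⟨h01, h02, h10⟩, h12, h20, h21⟩ := orthonormalBasis_inner_eq_zero w
    have hba : b - a = ‖b - a‖ • w 0 := by rw [hw, smul_smul, mul_inv_cancel₀ hd, one_smul]
    have hn : ∀ i, ‖w i‖ = 1 := w.orthonormal.1
    refine ⟨0, w 1, -2 * inner ℝ (w 1) (a - c), 0, w 2, -2 * inner ℝ (w 2) (a - c),
      by simp [hn], by simp [hn], by simp [h12], ?_⟩
    ext x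
    induction x using OnePoint.rec with
    | infty => simp
    | coe y =>
      have e : y - c = (y - a) + (a - c) := by abel
      simp only [Set.mem_insert_iff, OnePoint.coe_ne_infty, false_or, Set.mem_image,
        OnePoint.coe_eq_coe, exists_eq_right, Set.mem_ofPred_eq, mem_affineSpan_pair_iff,
        Set.mem_inter_iff, coe_mem_genSphere]
      rw [e, inner_add_right, inner_add_right]
      constructor
      · rintro ⟨t, rfl⟩
        rw [add_sub_cancel_left, hba, smul_smul, inner_smul_right, inner_smul_right, h10, h20]
        constructor <;> ring
      · rintro ⟨h1, h2⟩
        refine ⟨inner ℝ (w 0) (y - a) / ‖b - a‖, ?_⟩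
        rw [← sub_eq_iff_eq_add']
        have : (inner ℝ (w 0) (y - a) / ‖b - a‖) • (b - a) = inner ℝ (w 0) (y - a) • w 0 := by
          rw [hw, smul_smul, div_eq_mul_inv]
        rw [this]
        apply eq_of_orthonormalBasis_inner_eq w <;>
          simp only [inner_smul_right, hwi, h10, h20] <;> linarith

theorem isCircle_genSphere_inter_plane {c : E3} {α γ γ' : ℝ} {β β' : E3} (hα : α ≠ 0)
    (h : 0 < ‖β‖ ^ 2 - α * γ) (hβ' : β' ≠ 0) (hB : 2 * inner ℝ β β' = α * γ') :
    IsCircle (genSphere c α β γ ∩ genSphere c 0 β' γ') := by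
  have hQ : 0 < (‖β‖ ^ 2 - α * γ) / α ^ 2 := by positivity
  have : Fact (Module.finrank ℝ E3 = 2 + 1) := ⟨by simp⟩
  refine Or.inl ⟨⟨c - α⁻¹ • β, √((‖β‖ ^ 2 - α * γ) / α ^ 2)⟩,
    AffineSubspace.mk' (c - α⁻¹ • β) (Submodule.span ℝ {β'})ᗮ, Real.sqrt_pos.2 hQ,
    AffineSubspace.self_mem_mk' _ _, ?_, ?_⟩
  · rw [AffineSubspace.direction_mk', Submodule.finrank_orthogonal_span_singleton (n := 2) hβ']
  · ext x
    induction x using OnePoint.rec with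
    | infty => simp [hα]
    | coe y =>
      have e : y - (c - α⁻¹ • β) = (y - c) + α⁻¹ • β := by abel
      simp only [Set.mem_image, OnePoint.coe_eq_coe, exists_eq_right, Set.mem_ofPred_eq,
        Set.mem_inter_iff, coe_mem_genSphere, AffineSubspace.mem_mk',
        EuclideanGeometry.mem_sphere, dist_eq_norm,
        Submodule.mem_orthogonal_singleton_iff_inner_right, vsub_eq_sub]
      rw [← sq_eq_sq₀ (norm_nonneg _) (Real.sqrt_nonneg _), Real.sq_sqrt hQ.le, e,
        norm_add_sq_real, inner_add_right, inner_smul_right, inner_smul_right, norm_smul,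
        mul_pow, real_inner_comm β (y - c), real_inner_comm β β', Real.norm_eq_abs, sq_abs]
      have h1 : inner ℝ β β' = α * γ' / 2 := by linarith
      have h2 : α⁻¹ * (α * γ' / 2) = γ' / 2 := by field_simp
      rw [h1, h2, eq_div_iff (by positivity : α ^ 2 ≠ 0)]
      have h3 : (‖y - c‖ ^ 2 + 2 * (α⁻¹ * inner ℝ β (y - c)) + α⁻¹ ^ 2 * ‖β‖ ^ 2) * α ^ 2
          = α * (α * ‖y - c‖ ^ 2 + 2 * inner ℝ β (y - c)) + ‖β‖ ^ 2 := by
        field_simp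
      rw [h3, and_comm]
      refine and_congr ?_ ?_
      · constructor <;> intro h <;> linarith
      · constructor
        · intro h; linear_combination α * h
        · intro h
          apply mul_left_cancel₀ hα
          linear_combination h

theorem isCircle_plane_inter_plane {c : E3} {γ γ' : ℝ} {β β' : E3} (hβ : β ≠ 0) (hβ' : β' ≠ 0)
    (hB : inner ℝ β β' = 0) : IsCircle (genSphere c 0 β γ ∩ genSphere c 0 β' γ') := by
  have hb : ‖β‖ ≠ 0 := norm_ne_zero_iff.2 hβ
  have hb' : ‖β'‖ ≠ 0 := norm_ne_zero_iff.2 hβ'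
  obtain ⟨w, hw1, hw2⟩ := exists_orthonormalBasis_of_orthogonal_units
    (d := ‖β‖⁻¹ • β) (e := ‖β'‖⁻¹ • β')
    (by rw [norm_smul, norm_inv, norm_norm, inv_mul_cancel₀ hb])
    (by rw [norm_smul, norm_inv, norm_norm, inv_mul_cancel₀ hb'])
    (by rw [inner_smul_left, inner_smul_right, hB]; simp)
  have hwi := orthonormalBasis_inner_self w
  obtain ⟨⟨h01, h02, h10⟩, h12, h20, h21⟩ := orthonormalBasis_inner_eq_zero w
  have e1 : β = ‖β‖ • w 1 := by rw [hw1, smul_smul, mul_inv_cancel₀ hb, one_smul]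
  have e2 : β' = ‖β'‖ • w 2 := by rw [hw2, smul_smul, mul_inv_cancel₀ hb', one_smul]
  set a : E3 := c + (-(γ / (2 * ‖β‖))) • w 1 + (-(γ' / (2 * ‖β'‖))) • w 2 with ha
  refine Or.inr ⟨a, a + w 0, by simpa using fun h => w.orthonormal.ne_zero 0 h, ?_⟩
  ext x
  induction x using OnePoint.rec with
  | infty => simp
  | coe y =>
    simp only [Set.mem_insert_iff, OnePoint.coe_ne_infty, false_or, Set.mem_image,
      OnePoint.coe_eq_coe, exists_eq_right, Set.mem_ofPred_eq, mem_affineSpan_pair_iff,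
      Set.mem_inter_iff, coe_mem_genSphere, add_sub_cancel_left]
    have k1 : ‖β‖ * (γ / (2 * ‖β‖)) = γ / 2 := by field_simp
    have k2 : ‖β'‖ * (γ' / (2 * ‖β'‖)) = γ' / 2 := by field_simp
    have j1 : inner ℝ β (y - c) = ‖β‖ * inner ℝ (w 1) (y - c) := by
      conv_lhs => rw [e1, inner_smul_left]
      simp
    have j2 : inner ℝ β' (y - c) = ‖β'‖ * inner ℝ (w 2) (y - c) := by
      conv_lhs => rw [e2, inner_smul_left]
      simp
    rw [j1, j2]
    constructor
    · rintro ⟨h1, h2⟩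
      refine ⟨inner ℝ (w 0) (y - c), ?_⟩
      rw [ha, add_assoc, add_assoc, ← sub_eq_iff_eq_add']
      have i1 : inner ℝ (w 1) (y - c) = -(γ / (2 * ‖β‖)) := by
        apply mul_left_cancel₀ hb; linarith
      have i2 : inner ℝ (w 2) (y - c) = -(γ' / (2 * ‖β'‖)) := by
        apply mul_left_cancel₀ hb'; linarith
      apply eq_of_orthonormalBasis_inner_eq w <;>
        simp only [inner_add_right, inner_smul_right, hwi, h01, h02, h10, h12, h20, h21, i1, i2] <;>
        ring
    · rintro ⟨t, rfl⟩
      have : a + t • w 0 - c = (-(γ / (2 * ‖β‖))) • w 1 + (-(γ' / (2 * ‖β'‖))) • w 2 + t • w 0 := by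
        rw [ha]; abel
      rw [this]
      simp only [inner_add_right, inner_smul_right, hwi, h10, h12, h20, h21]
      constructor <;> linarith

/-- Circles are exactly the intersections of two orthogonal real generalized spheres. If the
pencil contains a proper sphere, it is spanned by a plane and by a sphere centered on that plane;
otherwise it consists of planes through a line. -/
theorem isCircle_iff_isOrthogonalSphereInter (c : E3) {S : Set M3} :
    IsCircle S ↔ IsOrthogonalSphereInter c S := by
  refine ⟨isOrthogonalSphereInter_of_isCircle c, ?_⟩
  rintro ⟨α, β, γ, α', β', γ', hQ, hQ', hB, rfl⟩
  by_cases h0 : α = 0 ∧ α' = 0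
  · obtain ⟨rfl, rfl⟩ := h0
    refine isCircle_plane_inter_plane ?_ ?_ (by linarith)
    · rintro rfl; simp at hQ
    · rintro rfl; simp at hQ'
  · set Q := ‖β‖ ^ 2 - α * γ with hQd
    set Q' := ‖β'‖ ^ 2 - α' * γ' with hQd'
    have hA : 0 < α ^ 2 * Q' + α' ^ 2 * Q := by
      rcases not_and_or.1 h0 with h | h <;> positivity
    have hββ : ‖β‖ ^ 2 = Q + α * γ := by rw [hQd]; ring
    have hββ' : ‖β'‖ ^ 2 = Q' + α' * γ' := by rw [hQd']; ring
    have hn : ‖α' • β - α • β'‖ ^ 2 = α ^ 2 * Q' + α' ^ 2 * Q := by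
      rw [norm_sub_sq_real, norm_smul, norm_smul, inner_smul_left, inner_smul_right, mul_pow,
        mul_pow, hββ, hββ', Real.norm_eq_abs, Real.norm_eq_abs, sq_abs, sq_abs]
      simp only [conj_trivial]
      linear_combination (-α * α') * hB
    have key : genSphere c α β γ ∩ genSphere c α' β' γ' =
        genSphere c (α ^ 2 * Q' + α' ^ 2 * Q) ((α * Q') • β + (α' * Q) • β')
          (α * Q' * γ + α' * Q * γ') ∩
        genSphere c 0 (α' • β - α • β') (α' * γ - α * γ') := by
      ext x
      induction x using OnePoint.rec with
      | infty =>
        simp only [Set.mem_inter_iff, infty_mem_genSphere, and_true]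
        exact ⟨fun h => absurd h h0, fun h => absurd h hA.ne'⟩
      | coe y =>
        simp only [Set.mem_inter_iff, coe_mem_genSphere, inner_add_left, inner_sub_left,
          inner_smul_left, conj_trivial]
        constructor
        · rintro ⟨h1, h2⟩
          constructor
          · linear_combination (α * Q') * h1 + (α' * Q) * h2
          · linear_combination α' * h1 - α * h2
        · rintro ⟨h1, h2⟩
          constructor
          · apply mul_left_cancel₀ hA.ne'
            linear_combination α * h1 + (α' * Q) * h2
          · apply mul_left_cancel₀ hA.ne'
            linear_combination α' * h1 - (α * Q') * h2
    rw [key]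
    refine isCircle_genSphere_inter_plane hA.ne' ?_ ?_ ?_
    · have : ‖(α * Q') • β + (α' * Q) • β'‖ ^ 2 -
          (α ^ 2 * Q' + α' ^ 2 * Q) * (α * Q' * γ + α' * Q * γ') =
          Q * Q' * (α ^ 2 * Q' + α' ^ 2 * Q) := by
        rw [norm_add_sq_real, norm_smul, norm_smul, inner_smul_left, inner_smul_right, mul_pow,
          mul_pow, hββ, hββ', Real.norm_eq_abs, Real.norm_eq_abs, sq_abs, sq_abs]
        simp only [conj_trivial]
        linear_combination (α * Q' * α' * Q) * hB
      rw [this]; positivity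
    · intro h
      rw [h] at hn
      simp at hn
      linarith
    · simp only [inner_add_left, inner_sub_right, inner_smul_left, inner_smul_right, conj_trivial,
        real_inner_self_eq_norm_sq, hββ, hββ']
      rw [real_inner_comm β β'] 
      linear_combination (α' ^ 2 * Q - α ^ 2 * Q') * hB

/-! ### Inversions, isometries and Moebius transformations -/

@[simp] theorem sphereInversion_infty (c : E3) (R : ℝ) : sphereInversion c R ∞ = c := rfl

@[simp] theorem sphereInversion_center (c : E3) (R : ℝ) : sphereInversion c R c = ∞ :=
  if_pos rfl

theorem sphereInversion_coe {c y : E3} (R : ℝ) (hy : y ≠ c) :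
    sphereInversion c R y = (inversion c R y : E3) :=
  if_neg hy

theorem sphereInversion_sphereInversion (c : E3) {R : ℝ} (hR : 0 < R) (x : M3) :
    sphereInversion c R (sphereInversion c R x) = x := by
  induction x using OnePoint.rec with
  | infty => simp
  | coe y =>
    by_cases hy : y = c
    · subst hy; simp
    · rw [sphereInversion_coe R hy,
        sphereInversion_coe R (fun h => hy ((inversion_eq_center hR.ne').1 h)),
        inversion_inversion c hR.ne']

theorem tendsto_nhds_infty_iff {X : Type*} {l : Filter X} {f : X → M3} :
    Tendsto f l (𝓝 ∞) ↔ ∀ r : ℝ, ∀ᶠ x in l, ∀ y : E3, f x = y → r < ‖y‖ := by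
  constructor
  · intro h r
    have hs := OnePoint.hasBasis_nhds_infty.mem_of_mem
      (i := Metric.closedBall (0 : E3) r) ⟨Metric.isClosed_closedBall, isCompact_closedBall _ _⟩
    filter_upwards [h hs] with x hx y hy
    rcases hx with ⟨z, hz, hzx⟩ | hx
    · rw [hy, OnePoint.coe_eq_coe] at hzx
      subst hzx
      simpa using hz
    · rw [hy] at hx
      exact absurd hx (OnePoint.coe_ne_infty y)
  · intro h
    rw [OnePoint.hasBasis_nhds_infty.tendsto_right_iff]
    rintro s ⟨-, hs⟩
    obtain ⟨r, hr⟩ := hs.isBounded.subset_closedBall 0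
    filter_upwards [h r] with x hx
    by_cases h0 : f x = ∞
    · exact Or.inr h0
    · obtain ⟨y, hy⟩ := OnePoint.ne_infty_iff_exists.1 h0
      refine Or.inl ⟨y, fun hys => ?_, hy⟩
      have := hr hys
      rw [mem_closedBall_zero_iff] at this
      exact (hx y hy.symm).not_ge this

theorem coclosedCompact_eq_cobounded : coclosedCompact E3 = Bornology.cobounded E3 := by
  rw [coclosedCompact_eq_cocompact, Metric.cobounded_eq_cocompact]

theorem continuous_sphereInversion (c : E3) {R : ℝ} (hR : 0 < R) :
    Continuous (sphereInversion c R) := by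
  rw [continuous_iff_continuousAt]
  intro x
  induction x using OnePoint.rec with
  | infty =>
    rw [OnePoint.continuousAt_infty', coclosedCompact_eq_cobounded]
    have h1 : Tendsto (inversion c R) (Bornology.cobounded E3) (𝓝 c) := by
      rw [tendsto_iff_dist_tendsto_zero]
      simp_rw [dist_inversion_center]
      exact tendsto_const_nhds.div_atTop
        (((Metric.tendsto_dist_left_atTop_iff c).2 tendsto_id).congr fun y => dist_comm _ _)
    refine ((OnePoint.continuous_coe.tendsto c).comp h1).congr' ?_
    have : {c}ᶜ ∈ Bornology.cobounded E3 :=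
      Bornology.isBounded_def.1 Bornology.isBounded_singleton
    filter_upwards [this] with y hy
    exact (sphereInversion_coe R hy).symm
  | coe y =>
    rw [OnePoint.continuousAt_coe]
    by_cases hy : y = c
    · subst hy
      rw [← continuousWithinAt_compl_self, ContinuousWithinAt, Function.comp_apply,
        sphereInversion_center]
      have h1 := tendsto_inversion_nhdsNE_center_cobounded (c := y) hR.ne'
      rw [← coclosedCompact_eq_cobounded] at h1
      refine (OnePoint.tendsto_coe_infty.comp h1).congr' ?_
      filter_upwards [self_mem_nhdsWithin] with z hz
      exact (sphereInversion_coe R hz).symm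
    · have h1 : ContinuousAt (fun z => inversion c R z) y :=
        continuousAt_const.inversion continuousAt_const continuousAt_id hy
      refine (OnePoint.continuous_coe.continuousAt.comp h1).congr ?_
      filter_upwards [isOpen_ne.mem_nhds hy] with z hz
      exact (sphereInversion_coe R hz).symm

/-- Inversion in the sphere of radius `R` around `c` acts linearly on the coefficients of
generalized spheres written in coordinates centered at `c`. -/
theorem preimage_sphereInversion_genSphere (c : E3) {R : ℝ} (hR : 0 < R) (α : ℝ) (β : E3)
    (γ : ℝ) : sphereInversion c R ⁻¹' genSphere c α β γ =
      genSphere c γ (R ^ 2 • β) (R ^ 4 * α) := by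
  ext x
  induction x using OnePoint.rec with
  | infty => simp
  | coe y =>
    by_cases hy : y = c
    · subst hy; simp [hR.ne']
    · have hn : ‖y - c‖ ≠ 0 := norm_ne_zero_iff.2 (sub_ne_zero.2 hy)
      rw [Set.mem_preimage, sphereInversion_coe R hy, coe_mem_genSphere, coe_mem_genSphere]
      have e : inversion c R y - c = (R / ‖y - c‖) ^ 2 • (y - c) := by
        simp [inversion, dist_eq_norm]
      rw [e, norm_smul, inner_smul_left, inner_smul_right, Real.norm_eq_abs, mul_pow, sq_abs]
      have key : γ * ‖y - c‖ ^ 2 + 2 * ((R ^ 2 : ℝ) * inner ℝ β (y - c)) + R ^ 4 * α =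
          ‖y - c‖ ^ 2 * (α * (((R / ‖y - c‖) ^ 2) ^ 2 * ‖y - c‖ ^ 2) +
            2 * ((R / ‖y - c‖) ^ 2 * inner ℝ β (y - c)) + γ) := by
        field_simp
        ring
      simp only [conj_trivial]
      rw [key, mul_eq_zero, or_iff_right (pow_ne_zero 2 hn)]

theorem IsCircle.image_sphereInversion {S : Set M3} (hS : IsCircle S) (c : E3) {R : ℝ}
    (hR : 0 < R) : IsCircle (sphereInversion c R '' S) := by
  have hinv : Function.LeftInverse (sphereInversion c R) (sphereInversion c R) :=
    sphereInversion_sphereInversion c hR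
  rw [Set.image_eq_preimage_of_inverse hinv hinv]
  rw [isCircle_iff_isOrthogonalSphereInter c] at hS ⊢
  obtain ⟨α, β, γ, α', β', γ', hQ, hQ', hB, rfl⟩ := hS
  refine ⟨γ, R ^ 2 • β, R ^ 4 * α, γ', R ^ 2 • β', R ^ 4 * α', ?_, ?_, ?_, ?_⟩
  · rw [norm_smul, Real.norm_eq_abs, mul_pow, sq_abs]
    have := mul_pos (pow_pos hR 4) hQ
    linarith
  · rw [norm_smul, Real.norm_eq_abs, mul_pow, sq_abs]
    have := mul_pos (pow_pos hR 4) hQ'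
    linarith
  · rw [inner_smul_left, inner_smul_right]
    simp only [conj_trivial]
    linear_combination R ^ 4 * hB
  · rw [Set.preimage_inter, preimage_sphereInversion_genSphere c hR,
      preimage_sphereInversion_genSphere c hR]

theorem map_isometry_inv (φ : E3 ≃ᵢ E3) (x : M3) :
    OnePoint.map φ.symm (OnePoint.map φ x) = x := by
  induction x using OnePoint.rec <;> simp

theorem continuous_map_isometry (φ : E3 ≃ᵢ E3) : Continuous (OnePoint.map φ : M3 → M3) :=
  by
  refine OnePoint.continuous_map φ.continuous ?_
  rw [coclosedCompact_eq_cocompact]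
  exact φ.toHomeomorph.isClosedEmbedding.tendsto_cocompact

theorem IsCircle.image_isometry {S : Set M3} (hS : IsCircle S) (φ : E3 ≃ᵢ E3) :
    IsCircle (OnePoint.map φ '' S) := by
  rw [Set.image_eq_preimage_of_inverse (map_isometry_inv φ) (map_isometry_inv φ.symm)]
  rw [isCircle_iff_isOrthogonalSphereInter (φ.symm 0)] at hS
  rw [isCircle_iff_isOrthogonalSphereInter 0]
  obtain ⟨α, β, γ, α', β', γ', hQ, hQ', hB, rfl⟩ := hS
  set L := φ.symm.toRealAffineIsometryEquiv.linearIsometryEquiv with hL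
  have hφ : ∀ y, φ.symm y - φ.symm 0 = L y := fun y => by
    have := φ.symm.toRealAffineIsometryEquiv.map_vsub y 0
    simpa using this.symm
  have key : ∀ α β γ, OnePoint.map φ.symm ⁻¹' genSphere (φ.symm 0) α β γ =
      genSphere 0 α (L.symm β) γ := by
    intro α β γ
    ext x
    induction x using OnePoint.rec with
    | infty => simp
    | coe y =>
      have : inner ℝ β (L y) = inner ℝ (L.symm β) y := by
        rw [← L.inner_map_map (L.symm β) y, L.apply_symm_apply]
      simp only [Set.mem_preimage, OnePoint.map_some, coe_mem_genSphere, hφ, sub_zero,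
        L.norm_map, this]
  refine ⟨α, L.symm β, γ, α', L.symm β', γ', ?_, ?_, ?_, ?_⟩
  · rwa [L.symm.norm_map]
  · rwa [L.symm.norm_map]
  · rwa [L.symm.inner_map_map]
  · rw [Set.preimage_inter, key, key]

theorem IsMoebius.comp {g h : M3 → M3} (hg : IsMoebius g) (hh : IsMoebius h) :
    IsMoebius (g ∘ h) := by
  induction hg with
  | id => exact hh
  | inversion c R hR g _ ih => exact .inversion c R hR _ ih
  | isometry φ g _ ih => exact .isometry φ _ ih

theorem isMoebius_sphereInversion (c : E3) {R : ℝ} (hR : 0 < R) :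
    IsMoebius (sphereInversion c R) :=
  .inversion c R hR _ .id

theorem isMoebius_map_isometry (φ : E3 ≃ᵢ E3) : IsMoebius (OnePoint.map φ) :=
  .isometry φ _ .id

theorem IsMoebius.exists_inverse {g : M3 → M3} (hg : IsMoebius g) :
    ∃ g', IsMoebius g' ∧ Function.LeftInverse g' g ∧ Function.RightInverse g' g := by
  induction hg with
  | id => exact ⟨_, .id, fun _ => rfl, fun _ => rfl⟩
  | inversion c R hR g _ ih =>
    obtain ⟨g', hg', hl, hr⟩ := ih
    exact ⟨_, hg'.comp (isMoebius_sphereInversion c hR),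
      .comp (sphereInversion_sphereInversion c hR) hl,
      .comp (sphereInversion_sphereInversion c hR) hr⟩
  | isometry φ g _ ih =>
    obtain ⟨g', hg', hl, hr⟩ := ih
    exact ⟨_, hg'.comp (isMoebius_map_isometry φ.symm), .comp (map_isometry_inv φ) hl,
      .comp (map_isometry_inv φ.symm) hr⟩

theorem IsMoebius.injective {g : M3 → M3} (hg : IsMoebius g) : Function.Injective g :=
  hg.exists_inverse.choose_spec.2.1.injective

theorem IsMoebius.continuous {g : M3 → M3} (hg : IsMoebius g) : Continuous g := by
  induction hg with
  | id => exact continuous_id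
  | inversion c R hR g _ ih => exact (continuous_sphereInversion c hR).comp ih
  | isometry φ g _ ih => exact (continuous_map_isometry φ).comp ih

theorem IsCircle.image {S : Set M3} (hS : IsCircle S) {g : M3 → M3} (hg : IsMoebius g) :
    IsCircle (g '' S) := by
  induction hg with
  | id => simpa using hS
  | inversion c R hR g _ ih => rw [Set.image_comp]; exact ih.image_sphereInversion c hR
  | isometry φ g _ ih => rw [Set.image_comp]; exact ih.image_isometry φ

/-! ### Incidence of points and circles -/

theorem isCircle_line {a b : E3} (hab : a ≠ b) :
    IsCircle (insert ∞ (((↑) : E3 → M3) '' {x | x ∈ line[ℝ, a, b]})) :=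
  Or.inr ⟨a, b, hab, rfl⟩

theorem IsCircle.eq_line {S : Set M3} (hS : IsCircle S) (h : ∞ ∈ S) :
    ∃ a b : E3, a ≠ b ∧ S = insert ∞ (((↑) : E3 → M3) '' {x | x ∈ line[ℝ, a, b]}) := by
  rcases hS with ⟨s, P, -, -, -, rfl⟩ | h
  · simp at h
  · exact h

theorem IsCircle.eq_line_of_mem {S : Set M3} (hS : IsCircle S) (h : ∞ ∈ S) {y z : E3}
    (hy : (y : M3) ∈ S) (hz : (z : M3) ∈ S) (hyz : y ≠ z) :
    S = insert ∞ (((↑) : E3 → M3) '' {x | x ∈ line[ℝ, y, z]}) := by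
  obtain ⟨a, b, -, rfl⟩ := hS.eq_line h
  simp only [Set.mem_insert_iff, OnePoint.coe_ne_infty, Set.mem_image, Set.mem_ofPred_eq,
    OnePoint.coe_eq_coe, exists_eq_right, false_or] at hy hz
  rw [affineSpan_pair_eq_of_mem_of_mem_of_ne hy hz hyz]

theorem exists_isMoebius_eq_infty (a : M3) : ∃ g, IsMoebius g ∧ g a = ∞ := by
  induction a using OnePoint.rec with
  | infty => exact ⟨_, .id, rfl⟩
  | coe y => exact ⟨_, isMoebius_sphereInversion y one_pos, sphereInversion_center y 1⟩

/-- A circle is determined by three of its points. -/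
theorem IsCircle.eq_of_mem {S T : Set M3} (hS : IsCircle S) (hT : IsCircle T) {a b c : M3}
    (haS : a ∈ S) (hbS : b ∈ S) (hcS : c ∈ S) (haT : a ∈ T) (hbT : b ∈ T) (hcT : c ∈ T)
    (hab : a ≠ b) (hac : a ≠ c) (hbc : b ≠ c) : S = T := by
  obtain ⟨g, hg, ha⟩ := exists_isMoebius_eq_infty a
  have hi := hg.injective
  obtain ⟨y, hy⟩ := OnePoint.ne_infty_iff_exists.1 (ha ▸ hi.ne hab.symm)
  obtain ⟨z, hz⟩ := OnePoint.ne_infty_iff_exists.1 (ha ▸ hi.ne hac.symm)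
  have hyz : y ≠ z := by
    rintro rfl
    exact hi.ne hbc (hy.symm.trans hz)
  have key : ∀ U, IsCircle U → a ∈ U → b ∈ U → c ∈ U →
      g '' U = insert ∞ (((↑) : E3 → M3) '' {x | x ∈ line[ℝ, y, z]}) := fun U hU h1 h2 h3 =>
    (hU.image hg).eq_line_of_mem ⟨a, h1, ha⟩ ⟨b, h2, hy.symm⟩ ⟨c, h3, hz.symm⟩ hyz
  exact hi.image_injective ((key S hS haS hbS hcS).trans (key T hT haT hbT hcT).symm)

theorem IsCircle.eq_of_infinite {S T : Set M3} (hS : IsCircle S) (hT : IsCircle T)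
    (h : (S ∩ T).Infinite) : S = T := by
  classical
  obtain ⟨t, ht, hcard⟩ := h.exists_subset_card_eq 3
  obtain ⟨a, b, c, hab, hac, hbc, rfl⟩ := Finset.card_eq_three.1 hcard
  have h : ∀ x ∈ ({a, b, c} : Finset M3), x ∈ S ∩ T := fun x hx => ht (Finset.mem_coe.2 hx)
  have ha := h a (by simp)
  have hb := h b (by simp)
  have hc := h c (by simp)
  exact hS.eq_of_mem hT ha.1 hb.1 hc.1 ha.2 hb.2 hc.2 hab hac hbc

theorem OnCommonCircle.map {a b c d : M3} (h : OnCommonCircle a b c d) {g : M3 → M3}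
    (hg : IsMoebius g) : OnCommonCircle (g a) (g b) (g c) (g d) := by
  obtain ⟨S, hS, ha, hb, hc, hd⟩ := h
  exact ⟨g '' S, hS.image hg, ⟨a, ha, rfl⟩, ⟨b, hb, rfl⟩, ⟨c, hc, rfl⟩, ⟨d, hd, rfl⟩⟩

theorem exists_isCircle_through_infty (b c : M3) : ∃ S, IsCircle S ∧ ∞ ∈ S ∧ b ∈ S ∧ c ∈ S := by
  have key : ∀ y z : E3, ∃ S, IsCircle S ∧ ∞ ∈ S ∧ (y : M3) ∈ S ∧ (z : M3) ∈ S := by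
    intro y z
    obtain ⟨w, hyw, hz⟩ : ∃ w, y ≠ w ∧ z ∈ line[ℝ, y, w] := by
      by_cases hyz : y = z
      · obtain ⟨w, hw⟩ := exists_ne y
        exact ⟨w, hw.symm, hyz ▸ left_mem_affineSpan_pair ℝ y w⟩
      · exact ⟨z, hyz, right_mem_affineSpan_pair ℝ y z⟩
    exact ⟨_, isCircle_line hyw, Or.inl rfl, Or.inr ⟨y, left_mem_affineSpan_pair ℝ y w, rfl⟩,
      Or.inr ⟨z, hz, rfl⟩⟩
  induction b using OnePoint.rec with
  | infty =>
    induction c using OnePoint.rec with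
    | infty => obtain ⟨S, h, h1, -, -⟩ := key 0 0; exact ⟨S, h, h1, h1, h1⟩
    | coe z => obtain ⟨S, h, h1, h2, -⟩ := key z z; exact ⟨S, h, h1, h1, h2⟩
  | coe y =>
    induction c using OnePoint.rec with
    | infty => obtain ⟨S, h, h1, h2, -⟩ := key y y; exact ⟨S, h, h1, h2, h1⟩
    | coe z => exact key y z

theorem exists_isCircle_through (a b c : M3) : ∃ S, IsCircle S ∧ a ∈ S ∧ b ∈ S ∧ c ∈ S := by
  obtain ⟨g, hg, ha⟩ := exists_isMoebius_eq_infty a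
  obtain ⟨g', hg', hl, -⟩ := hg.exists_inverse
  obtain ⟨S, hS, h1, h2, h3⟩ := exists_isCircle_through_infty (g b) (g c)
  exact ⟨g' '' S, hS.image hg', ⟨_, h1, ha ▸ hl a⟩, ⟨_, h2, hl b⟩, ⟨_, h3, hl c⟩⟩

/-! ### Moebius invariance of patches -/

theorem IsCircularArc.comp {γ : I → M3} (h : IsCircularArc γ) {g : M3 → M3} (hg : IsMoebius g) :
    IsCircularArc fun u => g (γ u) := by
  obtain ⟨hc, hi, S, hS, hr⟩ := h
  refine ⟨hg.continuous.comp hc, hg.injective.comp hi, g '' S, hS.image hg, ?_⟩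
  rintro _ ⟨u, rfl⟩
  exact ⟨γ u, hr ⟨u, rfl⟩, rfl⟩

theorem IsDupinCyclidePatch.comp {f : I × I → M3} (hf : IsDupinCyclidePatch f) {g : M3 → M3}
    (hg : IsMoebius g) : IsDupinCyclidePatch (g ∘ f) where
  continuous := hg.continuous.comp hf.continuous
  circular u u' v v' := (hf.circular u u' v v').map hg
  onCyclide := by
    obtain ⟨D, ⟨h, K, hh, hK, hK1, hK2, rfl⟩, hr⟩ := hf.onCyclide
    refine ⟨_, ⟨g ∘ h, K, hg.comp hh, hK, hK1, hK2, rfl⟩, ?_⟩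
    rw [Set.range_comp, Set.image_comp]
    exact Set.image_mono hr
  uLine v := (hf.uLine v).imp (fun h => h.comp hg) fun ⟨s, hs⟩ => ⟨g s, fun u => congrArg g (hs u)⟩
  vLine u := (hf.vLine u).imp (fun h => h.comp hg) fun ⟨s, hs⟩ => ⟨g s, fun v => congrArg g (hs v)⟩
  nondegenerate := by
    rintro ⟨S, hS, hr⟩
    obtain ⟨g', hg', hl, -⟩ := hg.exists_inverse
    refine hf.nondegenerate ⟨g' '' S, hS.image hg', ?_⟩
    rintro _ ⟨x, rfl⟩
    exact ⟨g (f x), hr ⟨x, rfl⟩, hl _⟩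

theorem OnCommonCircle.swap {a b c d : M3} (h : OnCommonCircle a b c d) :
    OnCommonCircle a d c b := by
  obtain ⟨S, hS, ha, hb, hc, hd⟩ := h
  exact ⟨S, hS, ha, hd, hc, hb⟩

theorem IsDupinCyclidePatch.swap {f : I × I → M3} (hf : IsDupinCyclidePatch f) :
    IsDupinCyclidePatch (f ∘ Prod.swap) where
  continuous := hf.continuous.comp continuous_swap
  circular u u' v v' := (hf.circular v v' u u').swap
  onCyclide := by
    obtain ⟨D, hD, hr⟩ := hf.onCyclide
    exact ⟨D, hD, (Set.range_comp_subset_range _ _).trans hr⟩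
  uLine := hf.vLine
  vLine := hf.uLine
  nondegenerate := by
    rintro ⟨S, hS, hr⟩
    refine hf.nondegenerate ⟨S, hS, ?_⟩
    rintro _ ⟨⟨u, v⟩, rfl⟩
    exact hr ⟨(v, u), rfl⟩

/-! ### Uniqueness of the patch -/

theorem coe_mem_line_iff {a b y : E3} :
    (y : M3) ∈ (insert ∞ (((↑) : E3 → M3) '' {x | x ∈ line[ℝ, a, b]}) : Set M3) ↔
      y ∈ line[ℝ, a, b] := by
  simp

/-- The secant theorem. Let `y ≠ p₁` lie on the line through `q` and `p₁`, and let `z ≠ p₂` lie on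
the line through `q` and `p₂`, or at infinity. If `z, y, p₁, p₂` are concyclic, the power of `q`
with respect to their circle, computed along the two secants, determines `z` from the rest. -/
theorem exists_eq_of_secant {q p₁ p₂ y : E3} {z : M3} {ν : ℝ} (hp : p₁ ≠ p₂)
    (hq : q ∉ line[ℝ, p₁, p₂]) (hy : y = q + ν • (p₁ - q)) (hyp : y ≠ p₁)
    (hz : z = ∞ ∨ ∃ w ∈ line[ℝ, q, p₂], z = (w : M3)) (hzp : z ≠ p₂)
    (h : OnCommonCircle z y p₁ p₂) :
    ∃ μ : ℝ, z = ((q + μ • (p₂ - q) : E3) : M3) ∧ μ * ‖p₂ - q‖ ^ 2 = ν * ‖p₁ - q‖ ^ 2 := by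
  obtain ⟨S, hS, h1, h2, h3, h4⟩ := h
  have hinf : ∞ ∉ S := by
    intro hinf
    rw [hS.eq_line_of_mem hinf h3 h4 hp, coe_mem_line_iff] at h2
    have hy' : y ∈ line[ℝ, q, p₁] := mem_affineSpan_pair_iff.2 ⟨ν, hy⟩
    apply hq
    rw [← affineSpan_pair_eq_of_mem_of_mem_of_ne h2 (left_mem_affineSpan_pair ℝ p₁ p₂) hyp,
      affineSpan_pair_eq_of_mem_of_mem_of_ne hy' (right_mem_affineSpan_pair ℝ q p₁) hyp]
    exact left_mem_affineSpan_pair ℝ q p₁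
  rcases hz with rfl | ⟨w, hw, rfl⟩
  · exact absurd h1 hinf
  obtain ⟨μ, rfl⟩ := mem_affineSpan_pair_iff.1 hw
  refine ⟨μ, rfl, ?_⟩
  rcases hS with ⟨s, P, hr, -, -, rfl⟩ | ⟨a, b, -, rfl⟩
  swap
  · exact absurd (Set.mem_insert _ _) hinf
  have key : ∀ {p : E3} {t : ℝ}, q + t • (p - q) ≠ p → p ∈ s → q + t • (p - q) ∈ s →
      t * ‖p - q‖ ^ 2 = ‖q - s.center‖ ^ 2 - s.radius ^ 2 := by
    intro p t hne hps hts
    have e1 : p - s.center = (q - s.center) + (p - q) := by abel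
    have e2 : q + t • (p - q) - s.center = (q - s.center) + t • (p - q) := by abel
    rw [EuclideanGeometry.mem_sphere, dist_eq_norm, ← sq_eq_sq₀ (norm_nonneg _) hr.le] at hps hts
    rw [e1, norm_add_sq_real] at hps
    rw [e2, norm_add_sq_real, norm_smul, inner_smul_right, mul_pow, Real.norm_eq_abs, sq_abs] at hts
    have ht : t - 1 ≠ 0 := by
      intro ht
      apply hne
      rw [sub_eq_zero.1 ht, one_smul, add_sub_cancel]
    apply mul_left_cancel₀ ht
    linear_combination hts - t * hps
  simp only [Set.mem_image, Set.mem_ofPred_eq, OnePoint.coe_eq_coe, exists_eq_right] at h1 h2 h3 h4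
  rw [key (fun h => hzp (congrArg _ h)) h4.2 h1.2, key (hy ▸ hyp) h3.2 (hy ▸ h2.2)]

/-- If a parameter line `γ` of a patch leaves the circle `C`, it agrees with an injective curve `δ`
on `C` for finitely many parameters only: an arc with more coincidences would run on `C`. -/
theorem finite_setOf_eq {γ δ : I → M3} (hγ : IsCircularArc γ ∨ ∃ s, ∀ u, γ u = s)
    (hδ : Function.Injective δ) {C : Set M3} (hC : IsCircle C) (hδC : ∀ u, δ u ∈ C)
    {u₀ : I} (hu₀ : γ u₀ ∉ C) : {u | γ u = δ u}.Finite := by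
  by_contra hinf
  replace hinf : {u | γ u = δ u}.Infinite := hinf
  rcases hγ with ⟨-, -, S, hS, hr⟩ | ⟨s, hs⟩
  · have : S = C := by
      refine hS.eq_of_infinite hC ((hinf.image hδ.injOn).mono ?_)
      rintro _ ⟨u, hu, rfl⟩
      exact ⟨hu ▸ hr ⟨u, rfl⟩, hδC u⟩
    exact hu₀ (this ▸ hr ⟨u₀, rfl⟩)
  · obtain ⟨u, hu, u', hu', hne⟩ := hinf.nontrivial
    exact hne (hδ (by rw [← hu, ← hu', hs, hs]))

theorem eq_of_eqOn_compl_finite {γ δ : I → M3} (hγ : Continuous γ) (hδ : Continuous δ)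
    {s : Set I} (hs : s.Finite) (h : ∀ u ∉ s, γ u = δ u) : γ = δ :=
  Continuous.ext_on (s := sᶜ) (Set.compl_eq_univ_sdiff s ▸ dense_univ.sdiff_finite hs) hγ hδ
    fun u hu => h u hu

theorem IsMoebiusTranslationPatch.eq_infty_or_mem_line {f : I × I → M3}
    (hf : IsMoebiusTranslationPatch f) (h00 : f (0, 0) = ∞) {u v : I} {p q : E3}
    (hp : f (u, 0) = p) (hq : f (0, v) = q) (hpq : p ≠ q) :
    f (u, v) = ∞ ∨ ∃ w ∈ line[ℝ, p, q], f (u, v) = w := by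
  obtain ⟨S, hS, h1, h2, h3, h4⟩ := hf.circular 0 u 0 v
  rw [h00] at h1
  rw [hp] at h2
  rw [hq] at h4
  rw [hS.eq_line_of_mem h1 h2 h4 hpq] at h3
  rcases h3 with h3 | ⟨w, hw, h3⟩
  · exact Or.inl h3
  · exact Or.inr ⟨w, hw, h3.symm⟩

/-- Two patches with the same boundary arcs issuing from `∞` and the same fourth corner agree, if
the end point of the second arc lies off the line `C₁` of the first one. The secant theorem
transports the agreement from the fourth corner along the row `v = 1`, and from there along the
columns. -/
theorem IsDupinCyclidePatch.eq_of_boundary_eq_aux {f g : I × I → M3} (hf : IsDupinCyclidePatch f)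
    (hg : IsDupinCyclidePatch g) (h00 : f (0, 0) = ∞) (hu : ∀ u, f (u, 0) = g (u, 0))
    (hv : ∀ v, f (0, v) = g (0, v)) (h11 : f (1, 1) = g (1, 1))
    (hiu : Function.Injective fun u => f (u, 0)) (hiv : Function.Injective fun v => f (0, v))
    {C₁ C₂ : Set M3} (hC₁ : IsCircle C₁) (hC₂ : IsCircle C₂) (hu₁ : ∀ u, f (u, 0) ∈ C₁)
    (hv₂ : ∀ v, f (0, v) ∈ C₂) (hinf : f (1, 1) ≠ ∞) (h10 : f (1, 1) ≠ f (1, 0))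
    (h01 : f (1, 1) ≠ f (0, 1)) (hC : f (0, 1) ∉ C₁) : f = g := by
  have hfin : ∀ {u}, u ≠ 0 → ∃ p : E3, f (u, 0) = p := fun {u} h => by
    obtain ⟨p, hp⟩ := OnePoint.ne_infty_iff_exists.1 (h00 ▸ hiu.ne h)
    exact ⟨p, hp.symm⟩
  have hfin' : ∀ {v}, v ≠ 0 → ∃ q : E3, f (0, v) = q := fun {v} h => by
    obtain ⟨p, hp⟩ := OnePoint.ne_infty_iff_exists.1 (h00 ▸ hiv.ne h)
    exact ⟨p, hp.symm⟩
  have hC₁inf : ∞ ∈ C₁ := h00 ▸ hu₁ 0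
  have hC₂inf : ∞ ∈ C₂ := h00 ▸ hv₂ 0
  obtain ⟨P, hP⟩ := hfin (u := 1) one_ne_zero
  obtain ⟨Q, hQ⟩ := hfin' (v := 1) one_ne_zero
  obtain ⟨X, hX⟩ := OnePoint.ne_infty_iff_exists.1 hinf
  have hPQ : P ≠ Q := by
    rintro rfl
    exact hC (hQ ▸ hP ▸ hu₁ 1)
  have hXP : X ≠ P := by
    rintro rfl
    exact h10 (hX.symm.trans hP.symm)
  obtain ⟨ν, hν⟩ : ∃ ν : ℝ, X = Q + ν • (P - Q) := by
    rcases hf.eq_infty_or_mem_line h00 hP hQ hPQ with h | ⟨w, hw, h⟩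
    · exact absurd h hinf
    · rw [← hX, OnePoint.coe_eq_coe] at h
      rw [Set.pair_comm] at hw
      exact mem_affineSpan_pair_iff.1 (h ▸ hw)
  -- The bad parameters `u`: those where the row `v = 1` touches the row `v = 0`, and those where
  -- the row `v = 0` touches `C₂`.
  set B : Set I := {0} ∪ {u | f (u, 1) = f (u, 0)} ∪ {u | g (u, 1) = f (u, 0)} ∪
    {u | f (u, 0) ∈ C₂} with hB
  have hCC : C₁ ≠ C₂ := by
    rintro rfl
    exact hC (hv₂ 1)
  have hBfin : B.Finite := by
    refine (((Set.finite_singleton _).union ?_).union ?_).union ?_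
    · exact finite_setOf_eq (hf.uLine 1) hiu hC₁ hu₁ (u₀ := 0) hC
    · exact finite_setOf_eq (hg.uLine 1) hiu hC₁ hu₁ (u₀ := 0) (hv 1 ▸ hC)
    · by_contra hi
      replace hi : {u | f (u, 0) ∈ C₂}.Infinite := hi
      refine hCC (hC₁.eq_of_infinite hC₂ ((hi.image hiu.injOn).mono ?_))
      rintro _ ⟨u, h, rfl⟩
      exact ⟨hu₁ u, h⟩
  -- Agreement on the row `v = 1`.
  have row : ∀ u ∉ B, ∃ w : E3, f (u, 1) = w ∧ g (u, 1) = w := by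
    intro u huB
    simp only [hB, Set.mem_union, Set.mem_singleton_iff, Set.mem_ofPred_eq, not_or] at huB
    obtain ⟨⟨⟨hu0, hfu⟩, hgu⟩, -⟩ := huB
    by_cases hu1 : u = 1
    · subst hu1
      exact ⟨X, hX.symm, h11 ▸ hX.symm⟩
    obtain ⟨p, hp⟩ := hfin hu0
    have hPp : P ≠ p := by
      rintro rfl
      exact hu1 (hiu (hp.trans hP.symm))
    have hline := hC₁.eq_line_of_mem hC₁inf (hP ▸ hu₁ 1) (hp ▸ hu₁ u) hPp
    have hQl : Q ∉ line[ℝ, P, p] := by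
      rw [hQ, hline, coe_mem_line_iff] at hC
      exact hC
    have hpQ : p ≠ Q := by
      rintro rfl
      exact hQl (right_mem_affineSpan_pair ℝ P p)
    have key : ∀ k : I × I → M3, IsDupinCyclidePatch k → (∀ u, f (u, 0) = k (u, 0)) →
        (∀ v, f (0, v) = k (0, v)) → f (1, 1) = k (1, 1) → k (u, 1) ≠ f (u, 0) →
        ∃ μ : ℝ, k (u, 1) = ((Q + μ • (p - Q) : E3) : M3) ∧
          μ * ‖p - Q‖ ^ 2 = ν * ‖P - Q‖ ^ 2 := by
      intro k hk hku hkv hk11 hne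
      refine exists_eq_of_secant hPp hQl hν hXP ?_ (hp ▸ hne) ?_
      · rw [Set.pair_comm]
        exact hk.eq_infty_or_mem_line (hku 0 ▸ h00) (hku u ▸ hp) (hkv 1 ▸ hQ) hpQ
      · have := hk.circular u 1 1 0
        rwa [← hk11, ← hku, ← hku, ← hX, hP, hp] at this
    obtain ⟨μ, hμ, hμ'⟩ := key f hf (fun _ => rfl) (fun _ => rfl) rfl hfu
    obtain ⟨κ, hκ, hκ'⟩ := key g hg hu hv h11 hgu
    have hn : ‖p - Q‖ ^ 2 ≠ 0 := pow_ne_zero 2 (norm_ne_zero_iff.2 (sub_ne_zero.2 hpQ))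
    rw [mul_right_cancel₀ hn (hκ'.trans hμ'.symm)] at hκ
    exact ⟨_, hμ, hκ⟩
  -- Agreement on the columns through good parameters `u`.
  have column : ∀ u ∉ B, (fun v => f (u, v)) = fun v => g (u, v) := by
    intro u huB
    obtain ⟨Y, hfY, hgY⟩ := row u huB
    simp only [hB, Set.mem_union, Set.mem_singleton_iff, Set.mem_ofPred_eq, not_or] at huB
    obtain ⟨⟨⟨hu0, hfu⟩, hgu⟩, huC⟩ := huB
    obtain ⟨p, hp⟩ := hfin hu0
    have hpQ : p ≠ Q := by
      rintro rfl
      exact huC (hp ▸ hQ ▸ hv₂ 1)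
    have hYQ : Y ≠ Q := by
      rintro rfl
      rcases hf.uLine 1 with ⟨-, hi, -⟩ | ⟨s, hs⟩
      · exact hu0 (hi (hfY.trans hQ.symm))
      · exact h01 ((hs 1).trans (hs 0).symm)
    obtain ⟨ρ, hρ⟩ : ∃ ρ : ℝ, Y = p + ρ • (Q - p) := by
      rcases hf.eq_infty_or_mem_line h00 hp hQ hpQ with h | ⟨w, hw, h⟩
      · exact absurd (hfY.symm.trans h) (OnePoint.coe_ne_infty Y)
      · rw [hfY, OnePoint.coe_eq_coe] at h
        exact mem_affineSpan_pair_iff.1 (h ▸ hw)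
    refine eq_of_eqOn_compl_finite (s := {0} ∪ {v | f (u, v) = f (0, v)} ∪
      {v | g (u, v) = f (0, v)}) (hf.continuous.comp (by fun_prop))
      (hg.continuous.comp (by fun_prop)) ?_ ?_
    · refine ((Set.finite_singleton _).union ?_).union ?_
      · exact finite_setOf_eq (hf.vLine u) hiv hC₂ hv₂ (u₀ := 0) huC
      · exact finite_setOf_eq (hg.vLine u) hiv hC₂ hv₂ (u₀ := 0) (hu u ▸ huC)
    · intro v hvB
      simp only [Set.mem_union, Set.mem_singleton_iff, Set.mem_ofPred_eq, not_or] at hvB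
      obtain ⟨⟨hv0, hfv⟩, hgv⟩ := hvB
      by_cases hv1 : v = 1
      · subst hv1
        exact hfY.trans hgY.symm
      obtain ⟨q, hq⟩ := hfin' hv0
      have hQq : Q ≠ q := by
        rintro rfl
        exact hv1 (hiv (hq.trans hQ.symm))
      have hline := hC₂.eq_line_of_mem hC₂inf (hQ ▸ hv₂ 1) (hq ▸ hv₂ v) hQq
      have hpl : p ∉ line[ℝ, Q, q] := by
        rw [hp, hline, coe_mem_line_iff] at huC
        exact huC
      have hpq : p ≠ q := by
        rintro rfl
        exact hpl (right_mem_affineSpan_pair ℝ Q p)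
      have key : ∀ k : I × I → M3, IsDupinCyclidePatch k → (∀ u, f (u, 0) = k (u, 0)) →
          (∀ v, f (0, v) = k (0, v)) → k (u, 1) = Y → k (u, v) ≠ f (0, v) →
          ∃ μ : ℝ, k (u, v) = ((p + μ • (q - p) : E3) : M3) ∧
            μ * ‖q - p‖ ^ 2 = ρ * ‖Q - p‖ ^ 2 := by
        intro k hk hku hkv hkY hne
        refine exists_eq_of_secant hQq hpl hρ hYQ ?_ (hq ▸ hne) ?_
        · exact hk.eq_infty_or_mem_line (hku 0 ▸ h00) (hku u ▸ hp) (hkv v ▸ hq) hpq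
        · have := (hk.circular u 0 v 1).swap
          rwa [hkY, ← hkv, ← hkv, hQ, hq] at this
      obtain ⟨μ, hμ, hμ'⟩ := key f hf (fun _ => rfl) (fun _ => rfl) hfY hfv
      obtain ⟨κ, hκ, hκ'⟩ := key g hg hu hv hgY hgv
      have hn : ‖q - p‖ ^ 2 ≠ 0 :=
        pow_ne_zero 2 (norm_ne_zero_iff.2 (sub_ne_zero.2 hpq.symm))
      rw [mul_right_cancel₀ hn (hκ'.trans hμ'.symm)] at hκ
      exact hμ.trans hκ.symm
  funext ⟨u, v⟩
  refine congrFun (eq_of_eqOn_compl_finite (γ := fun u => f (u, v)) (δ := fun u => g (u, v))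
    (hf.continuous.comp (by fun_prop)) (hg.continuous.comp (by fun_prop)) hBfin ?_) u
  exact fun u hu => congrFun (column u hu) v

theorem IsDupinCyclidePatch.eq_of_boundary_eq {f g : I × I → M3} (hf : IsDupinCyclidePatch f)
    (hg : IsDupinCyclidePatch g) (h00 : f (0, 0) = ∞) (hu : ∀ u, f (u, 0) = g (u, 0))
    (hv : ∀ v, f (0, v) = g (0, v)) (h11 : f (1, 1) = g (1, 1))
    (hpa : IsCircularArc fun u => f (u, 0)) (hqa : IsCircularArc fun v => f (0, v))
    (hpq : ¬ ∃ S, IsCircle S ∧ (∀ u, f (u, 0) ∈ S) ∧ ∀ v, f (0, v) ∈ S)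
    (hinf : f (1, 1) ≠ ∞) (h10 : f (1, 1) ≠ f (1, 0))
    (h01 : f (1, 1) ≠ f (0, 1)) (hne : f (1, 0) ≠ f (0, 1)) : f = g := by
  obtain ⟨-, hiu, C₁, hC₁, hr₁⟩ := hpa
  obtain ⟨-, hiv, C₂, hC₂, hr₂⟩ := hqa
  have hu₁ : ∀ u, f (u, 0) ∈ C₁ := fun u => hr₁ ⟨u, rfl⟩
  have hv₂ : ∀ v, f (0, v) ∈ C₂ := fun v => hr₂ ⟨v, rfl⟩
  by_cases h : f (0, 1) ∈ C₁
  · have h' : f (1, 0) ∉ C₂ := by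
      intro h'
      refine hpq ⟨C₁, hC₁, hu₁, ?_⟩
      have := hC₁.eq_of_mem hC₂ (hu₁ 0) (hu₁ 1) h (hv₂ 0) h' (hv₂ 1)
        (fun e => zero_ne_one (hiu e)) (fun e => zero_ne_one (hiv e)) hne
      exact this ▸ hv₂
    have := hf.swap.eq_of_boundary_eq_aux hg.swap h00 hv hu h11 hiv hiu hC₂ hC₁ hv₂ hu₁ hinf h01
      h10 h'
    funext ⟨u, v⟩
    exact congrFun this (v, u)
  · exact hf.eq_of_boundary_eq_aux hg h00 hu hv h11 hiu hiv hC₁ hC₂ hu₁ hv₂ hinf h10 h01 h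

/-! ### Existence of the patch: rotational and planar models -/

/-- There is a Dupin cyclide patch with boundary curves `p` and `q` and fourth corner `x`. -/
def HasPatch (p q : I → M3) (x : M3) : Prop :=
  ∃ f : I × I → M3, IsDupinCyclidePatch f ∧ (∀ u, f (u, 0) = p u) ∧ (∀ v, f (0, v) = q v) ∧
    f (1, 1) = x

theorem HasPatch.map {p q : I → M3} {x : M3} (h : HasPatch p q x) {g : M3 → M3}
    (hg : IsMoebius g) : HasPatch (g ∘ p) (g ∘ q) (g x) := by
  obtain ⟨f, hf, hp, hq, hx⟩ := h
  exact ⟨g ∘ f, hf.comp hg, fun u => congrArg g (hp u), fun v => congrArg g (hq v),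
    congrArg g hx⟩

theorem HasPatch.of_map {p q : I → M3} {x : M3} {g : M3 → M3} (hg : IsMoebius g)
    (h : HasPatch (g ∘ p) (g ∘ q) (g x)) : HasPatch p q x := by
  obtain ⟨g', hg', hl, -⟩ := hg.exists_inverse
  have := h.map hg'
  rwa [← Function.comp_assoc, ← Function.comp_assoc, hl.comp_eq_id, Function.id_comp,
    Function.id_comp, hl x] at this

theorem HasPatch.swap {p q : I → M3} {x : M3} (h : HasPatch p q x) : HasPatch q p x := by
  obtain ⟨f, hf, hp, hq, hx⟩ := h
  exact ⟨_, hf.swap, hq, hp, hx⟩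

/-- The four vertices of an isosceles trapezoid lie on a circle, also in degenerate cases. -/
theorem onCommonCircle_trapezoid {m m' e : E3} (h : inner ℝ e (m' - m) = 0) (s t : ℝ) :
    OnCommonCircle ((m - s • e : E3) : M3) ((m + s • e : E3) : M3) ((m' + t • e : E3) : M3)
      ((m' - t • e : E3) : M3) := by
  by_cases he : e = 0
  · obtain ⟨S, hS, h1, h2, -⟩ := exists_isCircle_through (m : M3) (m' : M3) ∞
    refine ⟨S, hS, ?_⟩
    simp [he, h1, h2]
  by_cases hm : m' = m
  · subst hm
    refine ⟨_, isCircle_line (a := m') (b := m' + e) (by simpa using he), ?_⟩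
    have key : ∀ i : ℝ, m' + i • e ∈ line[ℝ, m', m' + e] := fun i =>
      mem_affineSpan_pair_iff.2 ⟨i, by rw [add_sub_cancel_left]⟩
    refine ⟨coe_mem_line_iff.2 ?_, coe_mem_line_iff.2 (key s), coe_mem_line_iff.2 (key t),
      coe_mem_line_iff.2 ?_⟩
    · rw [sub_eq_add_neg, ← neg_smul]; exact key _
    · rw [sub_eq_add_neg, ← neg_smul]; exact key _
  set d := m' - m with hd
  have hd0 : d ≠ 0 := sub_ne_zero.2 hm
  have hd1 : 0 < ‖d‖ ^ 2 := by have := norm_pos_iff.2 hd0; positivity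
  have he1 : 0 < ‖e‖ ^ 2 := by have := norm_pos_iff.2 he; positivity
  -- The center divides the segment between the midpoints in the ratio `τ`, which is determined by
  -- its having the same distance from all vertices.
  set τ := (t ^ 2 * ‖e‖ ^ 2 - s ^ 2 * ‖e‖ ^ 2 + ‖d‖ ^ 2) / (2 * ‖d‖ ^ 2) with hτ
  have hτ' : s ^ 2 * ‖e‖ ^ 2 + τ ^ 2 * ‖d‖ ^ 2 = t ^ 2 * ‖e‖ ^ 2 + (1 - τ) ^ 2 * ‖d‖ ^ 2 := by
    have : τ * (2 * ‖d‖ ^ 2) = t ^ 2 * ‖e‖ ^ 2 - s ^ 2 * ‖e‖ ^ 2 + ‖d‖ ^ 2 :=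
      div_mul_cancel₀ _ (by positivity)
    linear_combination this
  have hρ : 0 < s ^ 2 * ‖e‖ ^ 2 + τ ^ 2 * ‖d‖ ^ 2 := by
    by_contra hρ
    have h1 : 0 ≤ s ^ 2 * ‖e‖ ^ 2 := by positivity
    have h2 : 0 ≤ τ ^ 2 * ‖d‖ ^ 2 := by positivity
    have h3 : 0 ≤ t ^ 2 * ‖e‖ ^ 2 := by positivity
    have h4 : τ ^ 2 * ‖d‖ ^ 2 = 0 := by linarith
    have h5 : τ = 0 := by simpa [hd0] using h4
    rw [h5] at hτ' hρ
    simp at hτ' hρ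
    linarith
  have hne : ‖e‖ ≠ 0 := norm_ne_zero_iff.2 he
  have hnd : ‖d‖ ≠ 0 := norm_ne_zero_iff.2 hd0
  obtain ⟨w, hw1, hw2⟩ := exists_orthonormalBasis_of_orthogonal_units
    (d := ‖e‖⁻¹ • e) (e := ‖d‖⁻¹ • d)
    (by rw [norm_smul, norm_inv, norm_norm, inv_mul_cancel₀ hne])
    (by rw [norm_smul, norm_inv, norm_norm, inv_mul_cancel₀ hnd])
    (by rw [inner_smul_left, inner_smul_right, h]; simp)
  have e1 : e = ‖e‖ • w 1 := by rw [hw1, smul_smul, mul_inv_cancel₀ hne, one_smul]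
  have e2 : d = ‖d‖ • w 2 := by rw [hw2, smul_smul, mul_inv_cancel₀ hnd, one_smul]
  obtain ⟨⟨h01, h02, -⟩, -⟩ := orthonormalBasis_inner_eq_zero w
  have hwe : inner ℝ (w 0) e = 0 := by rw [e1, inner_smul_right, h01, mul_zero]
  have hwd : inner ℝ (w 0) d = 0 := by rw [e2, inner_smul_right, h02, mul_zero]
  have key : ∀ (i j : ℝ) (x : E3), x - (m + τ • d) = i • e + j • d →
      i ^ 2 * ‖e‖ ^ 2 + j ^ 2 * ‖d‖ ^ 2 = s ^ 2 * ‖e‖ ^ 2 + τ ^ 2 * ‖d‖ ^ 2 →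
      (x : M3) ∈ genSphere (m + τ • d) 1 0 (-(s ^ 2 * ‖e‖ ^ 2 + τ ^ 2 * ‖d‖ ^ 2)) ∩
        genSphere (m + τ • d) 0 (w 0) 0 := by
    intro i j x hx hij
    constructor
    · rw [coe_mem_genSphere, hx, norm_add_sq_real, norm_smul, norm_smul, inner_smul_left,
        inner_smul_right, h, mul_pow, mul_pow, Real.norm_eq_abs, Real.norm_eq_abs, sq_abs, sq_abs,
        inner_zero_left]
      linear_combination hij
    · rw [coe_mem_genSphere, hx, inner_add_right, inner_smul_right, inner_smul_right, hwe, hwd]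
      simp
  have hm' : m' = m + d := by rw [hd]; abel
  refine ⟨_, isCircle_genSphere_inter_plane (c := m + τ • d) (α := 1) (β := 0)
    (γ := -(s ^ 2 * ‖e‖ ^ 2 + τ ^ 2 * ‖d‖ ^ 2)) (γ' := 0) (β' := w 0) one_ne_zero
    (by simpa using hρ) (w.orthonormal.ne_zero 0) (by simp),
    key (-s) (-τ) _ (by module) (by ring), key s (-τ) _ (by module) (by ring),
    key t (1 - τ) _ (by rw [hm']; module) hτ'.symm,
    key (-t) (1 - τ) _ (by rw [hm']; module) (by rw [neg_sq]; exact hτ'.symm)⟩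

/-- The rotation about the third coordinate axis as an isometry of Euclidean space. -/
def rotationIsometry (θ : ℝ) : E3 ≃ᵢ E3 :=
  IsometryEquiv.mk' (fun x : E3 =>
    !₂[Real.cos θ * x 0 - Real.sin θ * x 1, Real.sin θ * x 0 + Real.cos θ * x 1, x 2])
    (fun x : E3 =>
      !₂[Real.cos θ * x 0 + Real.sin θ * x 1, -Real.sin θ * x 0 + Real.cos θ * x 1, x 2])
    (fun x => by
      ext i
      fin_cases i
      · simp
        linear_combination x 0 * Real.sin_sq_add_cos_sq θ
      · simp
        linear_combination x 1 * Real.sin_sq_add_cos_sq θ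
      · simp)
    (Isometry.of_dist_eq fun x y => by
      rw [EuclideanSpace.dist_eq, EuclideanSpace.dist_eq]
      congr 1
      simp only [Fin.sum_univ_three, Real.dist_eq, sq_abs]
      simp
      linear_combination ((x 0 - y 0) ^ 2 + (x 1 - y 1) ^ 2) * Real.sin_sq_add_cos_sq θ)

@[simp] theorem rotation_infty (θ : ℝ) : rotation θ ∞ = ∞ := rfl

@[simp] theorem rotation_coe (θ : ℝ) (x : E3) : rotation θ x =
    ((!₂[Real.cos θ * x 0 - Real.sin θ * x 1, Real.sin θ * x 0 + Real.cos θ * x 1, x 2] : E3) :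
      M3) := rfl

theorem isMoebius_rotation (θ : ℝ) : IsMoebius (rotation θ) :=
  isMoebius_map_isometry (rotationIsometry θ)

theorem norm_sq_eq_sum (x : E3) : ‖x‖ ^ 2 = x 0 ^ 2 + x 1 ^ 2 + x 2 ^ 2 := by
  rw [EuclideanSpace.real_norm_sq_eq, Fin.sum_univ_three]

theorem coe_mem_meridianPlane {x : E3} : (x : M3) ∈ meridianPlane ↔ x 1 = 0 := by
  simp [meridianPlane]

theorem infty_mem_meridianPlane : ∞ ∈ meridianPlane := Or.inl rfl

/-- Only cosine and sine of the angle are required to vary continuously, since the angle may have to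
jump by `2π`. -/
theorem continuous_rotation {X : Type*} [TopologicalSpace X] {θ : X → ℝ}
    (hc : Continuous fun u => Real.cos (θ u)) (hs : Continuous fun u => Real.sin (θ u)) :
    Continuous fun x : X × M3 => rotation (θ x.1) x.2 := by
  rw [continuous_iff_continuousAt]
  rintro ⟨u, x⟩
  induction x using OnePoint.rec with
  | infty =>
    rw [ContinuousAt, rotation_infty, tendsto_nhds_infty_iff]
    intro r
    have h : Tendsto (Prod.snd : X × M3 → M3) (𝓝 (u, ∞)) (𝓝 ∞) := continuous_snd.tendsto _
    filter_upwards [tendsto_nhds_infty_iff.1 h r] with ⟨u', x'⟩ hx y hy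
    induction x' using OnePoint.rec with
    | infty => exact absurd hy.symm (OnePoint.coe_ne_infty y)
    | coe k =>
      have : ‖y‖ ^ 2 = ‖k‖ ^ 2 := by
        rw [rotation_coe, OnePoint.coe_eq_coe] at hy
        rw [← hy, norm_sq_eq_sum, norm_sq_eq_sum]
        simp
        linear_combination (k 0 ^ 2 + k 1 ^ 2) * Real.sin_sq_add_cos_sq (θ u')
      rw [(sq_eq_sq₀ (norm_nonneg _) (norm_nonneg _)).1 this]
      exact hx k rfl
  | coe k =>
    have he := (Topology.IsOpenEmbedding.id (X := X)).prodMap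
      (OnePoint.isOpenEmbedding_coe (X := E3))
    refine (he.continuousAt_iff (g := fun x : X × M3 => rotation (θ x.1) x.2) (x := (u, k))).1
      (Continuous.continuousAt ?_)
    refine OnePoint.continuous_coe.comp ?_
    refine (PiLp.continuous_toLp 2 _).comp (continuous_pi fun i => ?_)
    have hx : ∀ i, Continuous fun x : X × E3 => x.2 i := fun i => by fun_prop
    have hc' := hc.comp (continuous_fst (X := X) (Y := E3))
    have hs' := hs.comp (continuous_fst (X := X) (Y := E3))
    fin_cases i
    · exact (hc'.mul (hx 0)).sub (hs'.mul (hx 1))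
    · exact (hs'.mul (hx 0)).add (hc'.mul (hx 1))
    · exact hx 2

theorem onCommonCircle_rotation {k k' : M3} (hk : k ∈ meridianPlane) (hk' : k' ∈ meridianPlane)
    (θ θ' : ℝ) : OnCommonCircle (rotation θ k) (rotation θ' k) (rotation θ' k')
      (rotation θ k') := by
  induction k using OnePoint.rec with
  | infty =>
    obtain ⟨S, hS, h1, h2, h3⟩ := exists_isCircle_through ∞ (rotation θ' k') (rotation θ k')
    exact ⟨S, hS, h1, h1, h2, h3⟩
  | coe k =>
    induction k' using OnePoint.rec with
    | infty =>
      obtain ⟨S, hS, h1, h2, h3⟩ := exists_isCircle_through ∞ (rotation θ' k) (rotation θ k)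
      exact ⟨S, hS, h3, h2, h1, h1⟩
    | coe k' =>
      rw [coe_mem_meridianPlane] at hk hk'
      set c := Real.cos θ
      set s := Real.sin θ
      set c' := Real.cos θ'
      set s' := Real.sin θ'
      have h1 : c ^ 2 + s ^ 2 = 1 := Real.cos_sq_add_sin_sq θ
      have h2 : c' ^ 2 + s' ^ 2 = 1 := Real.cos_sq_add_sin_sq θ'
      have := onCommonCircle_trapezoid
        (m := !₂[k 0 * (c + c') / 2, k 0 * (s + s') / 2, k 2])
        (m' := !₂[k' 0 * (c + c') / 2, k' 0 * (s + s') / 2, k' 2])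
        (e := !₂[c' - c, s' - s, 0]) ?_ (k 0 / 2) (k' 0 / 2)
      · simp only [rotation_coe]
        convert this using 2 <;> ext i <;> fin_cases i <;> simp [hk, hk', c, s, c', s'] <;> ring
      · simp [PiLp.inner_apply, Fin.sum_univ_three]
        linear_combination (k' 0 - k 0) / 2 * (h2 - h1)

/-- The orbit of a point of the meridian plane off the axis lies on a circle. -/
theorem isCircle_orbit (k : E3) (hk : k 1 = 0) (hk0 : k 0 ≠ 0) :
    ∃ S, IsCircle S ∧ ∀ θ, rotation θ k ∈ S := by
  refine ⟨_, isCircle_genSphere_inter_plane (c := !₂[0, 0, k 2]) (α := 1) (β := 0)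
    (γ := -(k 0) ^ 2) (γ' := 0) (β' := !₂[0, 0, 1]) one_ne_zero ?_ ?_ ?_, fun θ => ?_⟩
  · simp; positivity
  · intro h
    simpa using congrArg (fun x : E3 => x 2) h
  · simp
  · rw [rotation_coe]
    constructor
    · rw [coe_mem_genSphere, norm_sq_eq_sum]
      simp [hk]
      linear_combination (k 0) ^ 2 * Real.sin_sq_add_cos_sq θ
    · rw [coe_mem_genSphere]
      simp [PiLp.inner_apply, Fin.sum_univ_three]

theorem isCircularArc_orbit_or_const {θ : I → ℝ} {k : M3}
    (hcont : Continuous fun u => rotation (θ u) k)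
    (hinj : ∀ u u', Real.cos (θ u) = Real.cos (θ u') → Real.sin (θ u) = Real.sin (θ u') → u = u')
    (hk : k ∈ meridianPlane) :
    IsCircularArc (fun u => rotation (θ u) k) ∨ ∃ s, ∀ u, rotation (θ u) k = s := by
  induction k using OnePoint.rec with
  | infty => exact Or.inr ⟨∞, fun u => rfl⟩
  | coe k =>
    rw [coe_mem_meridianPlane] at hk
    by_cases hk0 : k 0 = 0
    · refine Or.inr ⟨((!₂[0, 0, k 2] : E3) : M3), fun u => ?_⟩
      simp [hk, hk0]
    · obtain ⟨S, hS, hkS⟩ := isCircle_orbit k hk hk0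
      refine Or.inl ⟨hcont, fun u u' h => ?_, S, hS, ?_⟩
      · simp only [rotation_coe, OnePoint.coe_eq_coe] at h
        have h0 := congrArg (fun x : E3 => x 0) h
        have h1 := congrArg (fun x : E3 => x 1) h
        simp [hk, hk0] at h0 h1
        exact hinj u u' h0 h1
      · rintro _ ⟨u, rfl⟩
        exact hkS (θ u)

theorem rotation_eq_self {θ : ℝ} (hc : Real.cos θ = 1) (hs : Real.sin θ = 0) (x : M3) :
    rotation θ x = x := by
  induction x using OnePoint.rec with
  | infty => rfl
  | coe k =>
    rw [rotation_coe, hc, hs, OnePoint.coe_eq_coe]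
    ext i
    fin_cases i <;> simp

theorem rotation_radius (θ r : ℝ) : rotation θ ((!₂[r, 0, 0] : E3) : M3) =
    ((!₂[r * Real.cos θ, r * Real.sin θ, 0] : E3) : M3) := by
  rw [rotation_coe]
  simp [mul_comm]

theorem continuous_cos_sin_of_rotation {r : ℝ} (hr : r ≠ 0) {θ : I → ℝ}
    (h : Continuous fun u => rotation (θ u) ((!₂[r, 0, 0] : E3) : M3)) :
    (Continuous fun u => Real.cos (θ u)) ∧ Continuous fun u => Real.sin (θ u) := by
  have hy : Continuous fun u => (!₂[r * Real.cos (θ u), r * Real.sin (θ u), 0] : E3) := by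
    rw [OnePoint.isOpenEmbedding_coe.isInducing.continuous_iff]
    exact h.congr fun u => rotation_radius (θ u) r
  constructor
  · have h := ((by fun_prop : Continuous fun x : E3 => x 0).comp hy).div_const r
    exact h.congr fun u => by simp [hr]
  · have h := ((by fun_prop : Continuous fun x : E3 => x 1).comp hy).div_const r
    exact h.congr fun u => by simp [hr]

/-- The rotational model: if `p` runs along an orbit of the rotations about the axis and `q` along
a circle in the meridian plane, rotating `q` along `p` gives a patch. -/
theorem hasPatch_rotation {p q : I → M3} {r : ℝ} (hr : r ≠ 0) {θ : I → ℝ} (hp : IsCircularArc p)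
    (hq : IsCircularArc q) (hpθ : ∀ u, p u = rotation (θ u) ((!₂[r, 0, 0] : E3) : M3))
    (hp0 : p 0 = ((!₂[r, 0, 0] : E3) : M3)) (hq0 : q 0 = ((!₂[r, 0, 0] : E3) : M3)) {K : Set M3}
    (hK : IsCircle K) (hKm : K ⊆ meridianPlane) (hqK : ∀ v, q v ∈ K)
    (hpq : ¬ ∃ S, IsCircle S ∧ (∀ u, p u ∈ S) ∧ ∀ v, q v ∈ S) :
    HasPatch p q (rotation (θ 1) (q 1)) := by
  obtain ⟨hc, hs⟩ := continuous_cos_sin_of_rotation hr (hp.1.congr hpθ)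
  have hinj : ∀ u u', Real.cos (θ u) = Real.cos (θ u') → Real.sin (θ u) = Real.sin (θ u') →
      u = u' := fun u u' h h' => hp.2.1 (by rw [hpθ, hpθ, rotation_radius, rotation_radius, h, h'])
  have hθ0 : Real.cos (θ 0) = 1 ∧ Real.sin (θ 0) = 0 := by
    have h := hp0
    rw [hpθ, rotation_radius, OnePoint.coe_eq_coe] at h
    have h0 := congrArg (fun x : E3 => x 0) h
    have h1 := congrArg (fun x : E3 => x 1) h
    simp [hr] at h0 h1
    exact ⟨h0, h1⟩
  have hrot0 : ∀ x, rotation (θ 0) x = x := rotation_eq_self hθ0.1 hθ0.2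
  have hbp : ∀ u, rotation (θ u) (q 0) = p u := fun u => by rw [hq0, hpθ]
  have hcont : Continuous fun x : I × I => rotation (θ x.1) (q x.2) :=
    (continuous_rotation hc hs).comp (g := fun x : I × M3 => rotation (θ x.1) x.2)
      (f := fun x : I × I => (x.1, q x.2)) (continuous_fst.prodMk (hq.1.comp continuous_snd))
  have hcu : ∀ k, Continuous fun u => rotation (θ u) k := fun k =>
    (continuous_rotation hc hs).comp (g := fun x : I × M3 => rotation (θ x.1) x.2)
      (f := fun u : I => (u, k)) (continuous_id.prodMk continuous_const)
  have hD : IsDupinCyclide (id '' ⋃ θ : ℝ, rotation θ '' K) := by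
    refine ⟨id, K, .id, hK, hKm, ?_, rfl⟩
    intro h
    have := hqK 0
    rw [h, hq0] at this
    simp [axis, hr] at this
  have hpatch : IsDupinCyclidePatch fun x : I × I => rotation (θ x.1) (q x.2) :=
    { continuous := hcont
      circular := fun u u' v v' =>
        onCommonCircle_rotation (hKm (hqK v)) (hKm (hqK v')) (θ u) (θ u')
      onCyclide := by
        refine ⟨_, hD, ?_⟩
        rintro _ ⟨⟨u, v⟩, rfl⟩
        rw [Set.image_id]
        exact Set.mem_iUnion.2 ⟨θ u, Set.mem_image_of_mem _ (hqK v)⟩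
      uLine := fun v => isCircularArc_orbit_or_const (hcu (q v)) hinj (hKm (hqK v))
      vLine := fun u => Or.inl (hq.comp (isMoebius_rotation (θ u)))
      nondegenerate := by
        rintro ⟨S, hS, hr⟩
        refine hpq ⟨S, hS, fun u => ?_, fun v => ?_⟩
        · rw [← hbp u]
          exact hr ⟨(u, 0), rfl⟩
        · rw [← hrot0 (q v)]
          exact hr ⟨(0, v), rfl⟩ }
  exact ⟨_, hpatch, hbp, fun v => hrot0 (q v), rfl⟩

theorem exists_angle {x y r : ℝ} (hr : r ≠ 0) (h : x ^ 2 + y ^ 2 = r ^ 2) :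
    ∃ θ : ℝ, x = Real.cos θ * r ∧ y = Real.sin θ * r := by
  have hn : ‖(⟨x / r, y / r⟩ : ℂ)‖ = 1 := by
    rw [← sq_eq_sq₀ (norm_nonneg _) zero_le_one, Complex.sq_norm, Complex.normSq_mk]
    field_simp
    linarith
  have h1 := Complex.norm_mul_cos_arg (⟨x / r, y / r⟩ : ℂ)
  have h2 := Complex.norm_mul_sin_arg (⟨x / r, y / r⟩ : ℂ)
  rw [hn, one_mul] at h1 h2
  exact ⟨_, by rw [h1]; field_simp, by rw [h2]; field_simp⟩

/-- Addition of points of Moebius space, with `∞` absorbing, also for `∞ + ∞`. -/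
def addInfty (x y : M3) : M3 := x.elim ∞ fun a => y.elim ∞ fun b => ((a + b : E3) : M3)

@[simp] theorem infty_addInfty (y : M3) : addInfty ∞ y = ∞ := rfl

@[simp] theorem addInfty_infty (x : M3) : addInfty x ∞ = ∞ := by
  induction x using OnePoint.rec <;> rfl

@[simp] theorem coe_addInfty_coe (a b : E3) : addInfty a b = ((a + b : E3) : M3) := rfl

/-- Along orthogonal curves, addition extends continuously to `∞`. -/
theorem continuous_addInfty {X : Type*} [TopologicalSpace X] {p q : X → M3} (hp : Continuous p)
    (hq : Continuous q) (h : ∀ x (a b : E3), p x = a → q x = b → inner ℝ a b = 0) :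
    Continuous fun x => addInfty (p x) (q x) := by
  rw [continuous_iff_continuousAt]
  intro x
  by_cases hx : p x ≠ ∞ ∧ q x ≠ ∞
  · obtain ⟨a, ha⟩ := OnePoint.ne_infty_iff_exists.1 hx.1
    obtain ⟨b, hb⟩ := OnePoint.ne_infty_iff_exists.1 hx.2
    have he := (OnePoint.isOpenEmbedding_coe (X := E3)).prodMap
      (OnePoint.isOpenEmbedding_coe (X := E3))
    have h1 : ContinuousAt (fun y : M3 × M3 => addInfty y.1 y.2) ((a : M3), (b : M3)) :=
      (he.continuousAt_iff (g := fun y : M3 × M3 => addInfty y.1 y.2) (x := (a, b))).1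
        (OnePoint.continuous_coe.comp continuous_add).continuousAt
    rw [ha, hb] at h1
    exact ContinuousAt.comp (f := fun x => (p x, q x)) (x := x) h1
      (hp.prodMk hq).continuousAt
  · have hinf : addInfty (p x) (q x) = ∞ := by
      by_cases h1 : p x = ∞
      · simp [h1]
      · simp [not_not.1 fun h2 => hx ⟨h1, h2⟩]
    rw [ContinuousAt, hinf, tendsto_nhds_infty_iff]
    intro r
    have key : ∀ᶠ x' in 𝓝 x, ∀ a b : E3, p x' = a → q x' = b → r < ‖a‖ ∨ r < ‖b‖ := by
      by_cases h1 : p x = ∞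
      · have h2 := hp.tendsto x
        rw [h1, tendsto_nhds_infty_iff] at h2
        filter_upwards [h2 r] with x' hx' a b ha _
        exact Or.inl (hx' a ha)
      · have h2 := hq.tendsto x
        rw [not_not.1 fun h2 => hx ⟨h1, h2⟩, tendsto_nhds_infty_iff] at h2
        filter_upwards [h2 r] with x' hx' a b _ hb
        exact Or.inr (hx' b hb)
    filter_upwards [key] with x' hx' y hy
    by_cases h1 : p x' = ∞
    · simp [h1] at hy
    by_cases h2 : q x' = ∞
    · simp [h2] at hy
    obtain ⟨a, ha⟩ := OnePoint.ne_infty_iff_exists.1 h1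
    obtain ⟨b, hb⟩ := OnePoint.ne_infty_iff_exists.1 h2
    rw [← ha, ← hb, coe_addInfty_coe, OnePoint.coe_eq_coe] at hy
    have hn : ‖y‖ ^ 2 = ‖a‖ ^ 2 + ‖b‖ ^ 2 := by
      rw [← hy, norm_add_sq_real, h x' a b ha.symm hb.symm]
      ring
    rcases hx' a b ha.symm hb.symm with h3 | h3
    · exact h3.trans_le (abs_le_of_sq_le_sq' (by nlinarith [sq_nonneg ‖b‖]) (norm_nonneg _)).2
    · exact h3.trans_le (abs_le_of_sq_le_sq' (by nlinarith [sq_nonneg ‖a‖]) (norm_nonneg _)).2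

/-- The horizontal plane through the origin is a (degenerate) Dupin cyclide. -/
theorem isDupinCyclide_horizontalPlane :
    ∃ D, IsDupinCyclide D ∧ ∞ ∈ D ∧ ∀ s t : ℝ, ((!₂[s, t, 0] : E3) : M3) ∈ D := by
  have hne : (0 : E3) ≠ !₂[1, 0, 0] := fun h => by
    simpa using congrArg (fun x : E3 => x 0) h
  have hK : ∀ s : ℝ, !₂[s, 0, 0] ∈ line[ℝ, (0 : E3), !₂[1, 0, 0]] := fun s => by
    refine mem_affineSpan_pair_iff.2 ⟨s, ?_⟩
    ext i
    fin_cases i <;> simp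
  refine ⟨_, ⟨_, _, .id, isCircle_line hne, ?_, ?_, rfl⟩, ?_, fun s t => ?_⟩
  · rintro _ (rfl | ⟨y, hy, rfl⟩)
    · exact infty_mem_meridianPlane
    · obtain ⟨s, rfl⟩ := mem_affineSpan_pair_iff.1 hy
      simp [coe_mem_meridianPlane]
  · intro h
    have := coe_mem_line_iff.2 (hK 1)
    rw [h] at this
    simp [axis] at this
  · exact ⟨∞, Set.mem_iUnion.2 ⟨0, ∞, Or.inl rfl, rfl⟩, rfl⟩
  · refine ⟨_, Set.mem_iUnion.2 ⟨Complex.arg ⟨s, t⟩, _,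
      coe_mem_line_iff.2 (hK ‖(⟨s, t⟩ : ℂ)‖), rfl⟩, ?_⟩
    rw [rotation_coe, id, OnePoint.coe_eq_coe]
    ext i
    fin_cases i
    · simp [mul_comm]
    · simp [mul_comm]
    · simp

/-- The planar model: translating a segment along an orthogonal one. -/
theorem hasPatch_addInfty {p q : I → M3} (hp : IsCircularArc p) (hq : IsCircularArc q)
    (hp0 : p 0 = ((0 : E3) : M3)) (hq0 : q 0 = ((0 : E3) : M3))
    (hpl : ∀ u, p u = ∞ ∨ ∃ s : ℝ, p u = ((!₂[s, 0, 0] : E3) : M3))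
    (hql : ∀ v, q v = ∞ ∨ ∃ t : ℝ, q v = ((!₂[0, t, 0] : E3) : M3))
    (hpq : ¬ ∃ S, IsCircle S ∧ (∀ u, p u ∈ S) ∧ ∀ v, q v ∈ S) :
    HasPatch p q (addInfty (p 1) (q 1)) := by
  have hpl' : ∀ u (a : E3), p u = a → ∃ s : ℝ, a = !₂[s, 0, 0] := fun u a ha => by
    rcases hpl u with h | ⟨s, h⟩
    · simp [h] at ha
    · exact ⟨s, OnePoint.coe_injective (ha.symm.trans h)⟩
  have hql' : ∀ u (a : E3), q u = a → ∃ s : ℝ, a = !₂[0, s, 0] := fun u a ha => by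
    rcases hql u with h | ⟨s, h⟩
    · simp [h] at ha
    · exact ⟨s, OnePoint.coe_injective (ha.symm.trans h)⟩
  have horth : ∀ u v (a b : E3), p u = a → q v = b → inner ℝ a b = 0 := fun u v a b ha hb => by
    obtain ⟨s, rfl⟩ := hpl' u a ha
    obtain ⟨t, rfl⟩ := hql' v b hb
    simp [PiLp.inner_apply, Fin.sum_univ_three]
  have hbp : ∀ u, addInfty (p u) (q 0) = p u := fun u => by
    rw [hq0]
    generalize p u = x
    induction x using OnePoint.rec <;> simp
  have hbq : ∀ v, addInfty (p 0) (q v) = q v := fun v => by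
    rw [hp0]
    generalize q v = x
    induction x using OnePoint.rec <;> simp
  refine ⟨fun x => addInfty (p x.1) (q x.2), ⟨⟨?_, fun u u' v v' => ?_⟩, ?_, fun v => ?_,
    fun u => ?_, ?_⟩, hbp, hbq, rfl⟩
  · exact continuous_addInfty (hp.1.comp continuous_fst) (hq.1.comp continuous_snd)
      fun x a b => horth x.1 x.2 a b
  · simp only
    by_cases h1 : p u = ∞
    · obtain ⟨S, hS, h⟩ := exists_isCircle_through ∞ (addInfty (p u') (q v))
        (addInfty (p u') (q v'))
      exact ⟨S, hS, by simpa [h1] using ⟨h.1, h.2.1, h.2.2, h.1⟩⟩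
    by_cases h2 : p u' = ∞
    · obtain ⟨S, hS, h⟩ := exists_isCircle_through (addInfty (p u) (q v)) ∞
        (addInfty (p u) (q v'))
      exact ⟨S, hS, by simpa [h2] using h⟩
    by_cases h3 : q v = ∞
    · obtain ⟨S, hS, h⟩ := exists_isCircle_through ∞ (addInfty (p u') (q v'))
        (addInfty (p u) (q v'))
      exact ⟨S, hS, by simpa [h3] using h⟩
    by_cases h4 : q v' = ∞
    · obtain ⟨S, hS, h⟩ := exists_isCircle_through (addInfty (p u) (q v))
        (addInfty (p u') (q v)) ∞
      exact ⟨S, hS, by simpa [h4] using h⟩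
    obtain ⟨a, ha⟩ := OnePoint.ne_infty_iff_exists.1 h1
    obtain ⟨a', ha'⟩ := OnePoint.ne_infty_iff_exists.1 h2
    obtain ⟨b, hb⟩ := OnePoint.ne_infty_iff_exists.1 h3
    obtain ⟨b', hb'⟩ := OnePoint.ne_infty_iff_exists.1 h4
    have h : inner ℝ (a' - a) ((2⁻¹ : ℝ) • (a + a') + b' - ((2⁻¹ : ℝ) • (a + a') + b)) = 0 := by
      rw [add_sub_add_left_eq_sub, inner_sub_left, inner_sub_right, inner_sub_right,
        horth _ _ _ _ ha.symm hb.symm, horth _ _ _ _ ha.symm hb'.symm,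
        horth _ _ _ _ ha'.symm hb.symm, horth _ _ _ _ ha'.symm hb'.symm]
      simp
    have := onCommonCircle_trapezoid h 2⁻¹ 2⁻¹
    rw [← ha, ← ha', ← hb, ← hb']
    simp only [coe_addInfty_coe]
    convert this using 2 <;> module
  · obtain ⟨D, hD, hinf, hmem⟩ := isDupinCyclide_horizontalPlane
    refine ⟨D, hD, ?_⟩
    rintro _ ⟨⟨u, v⟩, rfl⟩
    rcases hpl u with h1 | ⟨s, h1⟩
    · simpa [h1] using hinf
    rcases hql v with h2 | ⟨t, h2⟩
    · simpa [h2] using hinf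
    have : (!₂[s, 0, 0] : E3) + !₂[0, t, 0] = !₂[s, t, 0] := by
      ext i
      fin_cases i <;> simp
    simpa only [h1, h2, coe_addInfty_coe, this] using hmem s t
  · generalize hb : q v = b
    induction b using OnePoint.rec with
    | infty => exact Or.inr ⟨∞, fun u => by simp [hb]⟩
    | coe b =>
      refine Or.inl ?_
      convert hp.comp (isMoebius_map_isometry (IsometryEquiv.addRight b)) using 2 with u
      simp only [hb]
      generalize p u = x
      induction x using OnePoint.rec <;> simp
  · generalize ha : p u = a
    induction a using OnePoint.rec with
    | infty => exact Or.inr ⟨∞, fun u => by simp [ha]⟩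
    | coe a =>
      refine Or.inl ?_
      convert hq.comp (isMoebius_map_isometry (IsometryEquiv.addLeft a)) using 2 with v
      simp only [ha]
      generalize q v = x
      induction x using OnePoint.rec <;> simp
  · rintro ⟨S, hS, hr⟩
    exact hpq ⟨S, hS, fun u => hbp u ▸ hr ⟨(u, 0), rfl⟩, fun v => hbq v ▸ hr ⟨(0, v), rfl⟩⟩

/-! ### Normal forms of the boundary data -/

theorem sphereInversion_eq_of_norm_sq {c y : E3} {R D : ℝ} (hD : ‖y - c‖ ^ 2 = D) (hD0 : D ≠ 0) :
    sphereInversion c R y = ((!₂[R ^ 2 / D * (y 0 - c 0) + c 0, R ^ 2 / D * (y 1 - c 1) + c 1,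
      R ^ 2 / D * (y 2 - c 2) + c 2] : E3) : M3) := by
  have hy : y ≠ c := by
    rintro rfl
    simp at hD
    exact hD0 hD.symm
  rw [sphereInversion_coe R hy, OnePoint.coe_eq_coe]
  ext i
  fin_cases i <;> simp [EuclideanGeometry.inversion, dist_eq_norm, div_pow, hD]

theorem not_onCircle_comp {p q : I → M3}
    (hpq : ¬ ∃ S, IsCircle S ∧ (∀ u, p u ∈ S) ∧ ∀ v, q v ∈ S) {g : M3 → M3} (hg : IsMoebius g) :
    ¬ ∃ S, IsCircle S ∧ (∀ u, (g ∘ p) u ∈ S) ∧ ∀ v, (g ∘ q) v ∈ S := by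
  rintro ⟨S, hS, h1, h2⟩
  obtain ⟨g', hg', hl, -⟩ := hg.exists_inverse
  exact hpq ⟨g' '' S, hS.image hg', fun u => ⟨_, h1 u, hl _⟩, fun v => ⟨_, h2 v, hl _⟩⟩

/-- Existence for boundary arcs on the orthogonal lines `(0, s, 0)` and `(-b, 0, t)`, when
`m = l (s² + t² + b²) - s²` is positive. The patch is a Moebius image of a surface of revolution
whose axis corresponds to the circle with center `0` and radius `√m` in the meridian plane;
inversion at a point of this circle leads to the rotational model. -/
theorem hasPatch_of_pos {p q : I → M3} (hp : IsCircularArc p) (hq : IsCircularArc q)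
    (hp0 : p 0 = ∞) (hq0 : q 0 = ∞) {b : ℝ}
    (hpl : ∀ u ≠ 0, ∃ s : ℝ, p u = ((!₂[0, s, 0] : E3) : M3))
    (hql : ∀ v ≠ 0, ∃ t : ℝ, q v = ((!₂[-b, 0, t] : E3) : M3))
    (hpq : ¬ ∃ S, IsCircle S ∧ (∀ u, p u ∈ S) ∧ ∀ v, q v ∈ S) {s t l : ℝ}
    (hp1 : p 1 = ((!₂[0, s, 0] : E3) : M3)) (hq1 : q 1 = ((!₂[-b, 0, t] : E3) : M3))
    (hm : 0 < l * (s ^ 2 + t ^ 2 + b ^ 2) - s ^ 2) :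
    HasPatch p q ((!₂[-(l * b), (1 - l) * s, l * t] : E3) : M3) := by
  -- The sign of `r` is chosen such that the center `(r, 0, 0)` misses the line that carries `q`.
  obtain ⟨r, hr, hr2, hbr⟩ : ∃ r : ℝ, r ≠ 0 ∧ r ^ 2 = l * (s ^ 2 + t ^ 2 + b ^ 2) - s ^ 2 ∧
      0 ≤ b * r := by
    have h1 := Real.sqrt_pos.2 hm
    have h2 := Real.sq_sqrt hm.le
    rcases le_total 0 b with h | h
    · exact ⟨_, h1.ne', h2, mul_nonneg h h1.le⟩
    · exact ⟨-√(l * (s ^ 2 + t ^ 2 + b ^ 2) - s ^ 2), neg_ne_zero.2 h1.ne', by rw [neg_sq, h2],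
        mul_nonneg_of_nonpos_of_nonpos h (by linarith)⟩
  have hr0 : 0 < r ^ 2 := by positivity
  set c : E3 := !₂[r, 0, 0] with hc
  set R : ℝ := √(2 * r ^ 2)
  have hR : 0 < R := Real.sqrt_pos.2 (by positivity)
  have hR2 : R ^ 2 = 2 * r ^ 2 := Real.sq_sqrt (by positivity)
  have hg := isMoebius_sphereInversion c hR
  have hinv : ∀ (x y z D : ℝ), (x - r) ^ 2 + y ^ 2 + z ^ 2 = D → D ≠ 0 →
      sphereInversion c R ((!₂[x, y, z] : E3) : M3) =
        ((!₂[2 * r ^ 2 / D * (x - r) + r, 2 * r ^ 2 / D * y, 2 * r ^ 2 / D * z] : E3) : M3) := by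
    intro x y z D hD hD0
    rw [sphereInversion_eq_of_norm_sq (D := D) (by rw [norm_sq_eq_sum]; simpa [hc] using hD) hD0,
      hR2, OnePoint.coe_eq_coe]
    ext i
    fin_cases i <;> simp [hc]
  have hθ : ∀ u, ∃ θ, (sphereInversion c R ∘ p) u = rotation θ (c : M3) := by
    intro u
    by_cases hu : u = 0
    · subst hu
      refine ⟨0, ?_⟩
      rw [Function.comp_apply, hp0, sphereInversion_infty, rotation_coe, OnePoint.coe_eq_coe]
      ext i
      fin_cases i <;> simp
    · obtain ⟨s, hs⟩ := hpl u hu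
      have hD : r ^ 2 + s ^ 2 ≠ 0 := by positivity
      obtain ⟨θ, h1, h2⟩ := exists_angle (x := 2 * r ^ 2 / (r ^ 2 + s ^ 2) * (0 - r) + r)
        (y := 2 * r ^ 2 / (r ^ 2 + s ^ 2) * s) hr (by field_simp; ring)
      refine ⟨θ, ?_⟩
      rw [Function.comp_apply, hs, hinv 0 s 0 (r ^ 2 + s ^ 2) (by ring) hD, h1, h2, rotation_coe]
      simp [hc]
  choose θ hθ using hθ
  have hne : (!₂[-b, 0, 0] : E3) ≠ !₂[-b, 0, 1] := fun h => by
    simpa using congrArg (fun x : E3 => x 2) h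
  refine HasPatch.of_map hg ?_
  have key := hasPatch_rotation hr (hp.comp hg) (hq.comp hg) hθ
    (show sphereInversion c R (p 0) = c by rw [hp0, sphereInversion_infty])
    (show sphereInversion c R (q 0) = c by rw [hq0, sphereInversion_infty])
    ((isCircle_line hne).image hg) ?_ ?_ (not_onCircle_comp hpq hg)
  · suffices hx : sphereInversion c R ((!₂[-(l * b), (1 - l) * s, l * t] : E3) : M3) =
        rotation (θ 1) (sphereInversion c R (q 1)) by
      rw [hx]
      exact key
    have hl : 0 < l := by
      by_contra hl
      have : l * (s ^ 2 + t ^ 2 + b ^ 2) ≤ 0 :=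
        mul_nonpos_of_nonpos_of_nonneg (not_lt.1 hl) (by positivity)
      nlinarith [sq_nonneg s]
    have hD : 0 < (b + r) ^ 2 + t ^ 2 := by nlinarith [sq_nonneg b, sq_nonneg t]
    have hD1 : 0 < r ^ 2 + s ^ 2 := by positivity
    have h1 := hθ 1
    rw [Function.comp_apply, hp1, hinv 0 s 0 (r ^ 2 + s ^ 2) (by ring) hD1.ne', rotation_coe,
      OnePoint.coe_eq_coe] at h1
    have hcos := congrArg (fun x : E3 => x 0) h1
    have hsin := congrArg (fun x : E3 => x 1) h1
    simp [hc] at hcos hsin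
    have hcos' : Real.cos (θ 1) = (s ^ 2 - r ^ 2) / (r ^ 2 + s ^ 2) := by
      apply mul_right_cancel₀ hr
      rw [← hcos]
      field_simp
      ring
    have hsin' : Real.sin (θ 1) = 2 * r * s / (r ^ 2 + s ^ 2) := by
      apply mul_right_cancel₀ hr
      rw [← hsin]
      field_simp
    have hE : l * ((b + r) ^ 2 + t ^ 2) =
        r ^ 2 + s ^ 2 - l * s ^ 2 + 2 * l * b * r + l * r ^ 2 := by
      linear_combination -hr2
    -- The squared distances of `x` and of `q 1` from the center of inversion
    -- have the ratio `l : 1`.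
    rw [hinv _ _ _ (l * ((b + r) ^ 2 + t ^ 2)) (by linear_combination (1 - l) * hr2)
      (by positivity), hq1, hinv _ _ _ ((b + r) ^ 2 + t ^ 2) (by ring) hD.ne', rotation_coe, hcos', hsin',
      OnePoint.coe_eq_coe]
    generalize (b + r) ^ 2 + t ^ 2 = D at *
    ext i
    fin_cases i
    · simp
      field_simp
      linear_combination (2 * r ^ 2) * hE
    · simp
      field_simp
      linear_combination (-s) * hE
    · simp
      field_simp
  · rintro _ ⟨_, rfl | ⟨y, hy, rfl⟩, rfl⟩
    · rw [sphereInversion_infty, coe_mem_meridianPlane]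
      simp [hc]
    · obtain ⟨t, rfl⟩ := mem_affineSpan_pair_iff.1 hy
      by_cases hcy : !₂[-b, 0, 0] + t • (!₂[-b, 0, 1] - !₂[-b, 0, 0]) = c
      · rw [hcy, sphereInversion_center]
        exact infty_mem_meridianPlane
      · rw [sphereInversion_coe R hcy, coe_mem_meridianPlane]
        simp [EuclideanGeometry.inversion, hc]
  · intro v
    by_cases hv : v = 0
    · subst hv
      exact ⟨∞, Or.inl rfl, by rw [hq0]⟩
    · obtain ⟨t, ht⟩ := hql v hv
      refine ⟨q v, Or.inr ⟨_, mem_affineSpan_pair_iff.2 ⟨t, ?_⟩, ht.symm⟩, rfl⟩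
      ext i
      fin_cases i <;> simp

/-- Existence for boundary arcs on orthogonal lines that meet at the origin, when the fourth corner
is the foot of the perpendicular from the origin. Inversion at the origin yields the planar
model. -/
theorem hasPatch_of_foot {p q : I → M3} (hp : IsCircularArc p) (hq : IsCircularArc q)
    (hp0 : p 0 = ∞) (hq0 : q 0 = ∞)
    (hpl : ∀ u ≠ 0, ∃ s : ℝ, p u = ((!₂[s, 0, 0] : E3) : M3))
    (hql : ∀ v ≠ 0, ∃ t : ℝ, q v = ((!₂[0, t, 0] : E3) : M3))
    (hpq : ¬ ∃ S, IsCircle S ∧ (∀ u, p u ∈ S) ∧ ∀ v, q v ∈ S) {s t l : ℝ}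
    (hp1 : p 1 = ((!₂[s, 0, 0] : E3) : M3)) (hq1 : q 1 = ((!₂[0, t, 0] : E3) : M3))
    (hs : s ≠ 0) (ht : t ≠ 0) (hm : l * (s ^ 2 + t ^ 2) = s ^ 2) :
    HasPatch p q ((!₂[(1 - l) * s, l * t, 0] : E3) : M3) := by
  have hg := isMoebius_sphereInversion 0 one_pos
  have hinv : ∀ (x y D : ℝ), x ^ 2 + y ^ 2 = D → D ≠ 0 →
      sphereInversion 0 1 ((!₂[x, y, 0] : E3) : M3) = ((!₂[x / D, y / D, 0] : E3) : M3) := by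
    intro x y D hD hD0
    rw [sphereInversion_eq_of_norm_sq (D := D) (by rw [norm_sq_eq_sum]; simpa using hD) hD0,
      OnePoint.coe_eq_coe]
    ext i
    fin_cases i <;> simp <;> ring
  have h0 : (!₂[0, 0, 0] : E3) = 0 := by
    ext i
    fin_cases i <;> simp
  have h1 : ∀ x, sphereInversion 0 1 ((!₂[x, 0, 0] : E3) : M3) = ∞ ∨
      ∃ y : ℝ, sphereInversion 0 1 ((!₂[x, 0, 0] : E3) : M3) = ((!₂[y, 0, 0] : E3) : M3) := by
    intro x
    by_cases hx : x = 0
    · left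
      rw [hx, h0, sphereInversion_center]
    · right
      exact ⟨x / x ^ 2, by rw [hinv x 0 (x ^ 2) (by ring) (by positivity), zero_div]⟩
  have h2 : ∀ x, sphereInversion 0 1 ((!₂[0, x, 0] : E3) : M3) = ∞ ∨
      ∃ y : ℝ, sphereInversion 0 1 ((!₂[0, x, 0] : E3) : M3) = ((!₂[0, y, 0] : E3) : M3) := by
    intro x
    by_cases hx : x = 0
    · left
      rw [hx, h0, sphereInversion_center]
    · right
      exact ⟨x / x ^ 2, by rw [hinv 0 x (x ^ 2) (by ring) (by positivity), zero_div]⟩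
  refine HasPatch.of_map hg ?_
  have key := hasPatch_addInfty (hp.comp hg) (hq.comp hg)
    (show sphereInversion 0 1 (p 0) = _ by rw [hp0, sphereInversion_infty])
    (show sphereInversion 0 1 (q 0) = _ by rw [hq0, sphereInversion_infty])
    (fun u => ?_) (fun v => ?_) (not_onCircle_comp hpq hg)
  · suffices hx : sphereInversion 0 1 ((!₂[(1 - l) * s, l * t, 0] : E3) : M3) =
        addInfty (sphereInversion 0 1 (p 1)) (sphereInversion 0 1 (q 1)) by
      rw [hx]
      exact key
    have hN : s ^ 2 + t ^ 2 ≠ 0 := by positivity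
    have hl : l = s ^ 2 / (s ^ 2 + t ^ 2) := by
      field_simp
      exact hm
    rw [hp1, hq1, hinv s 0 (s ^ 2) (by ring) (by positivity),
      hinv 0 t (t ^ 2) (by ring) (by positivity),
      hinv _ _ (s ^ 2 * t ^ 2 / (s ^ 2 + t ^ 2)) (by rw [hl]; field_simp; ring) (by positivity),
      coe_addInfty_coe, OnePoint.coe_eq_coe, hl]
    ext i
    fin_cases i
    · simp
      field_simp
      ring
    · simp
      field_simp
    · simp
  · by_cases hu : u = 0
    · subst hu
      exact Or.inr ⟨0, by rw [hp0, sphereInversion_infty, h0]⟩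
    · obtain ⟨s, hs⟩ := hpl u hu
      rw [hs]
      exact h1 s
  · by_cases hv : v = 0
    · subst hv
      exact Or.inr ⟨0, by rw [hq0, sphereInversion_infty, h0]⟩
    · obtain ⟨t, ht⟩ := hql v hv
      rw [ht]
      exact h2 t

/-- The isometry of Euclidean space given by an origin and an orthonormal frame. -/
def frameIsometry (a : E3) (w : OrthonormalBasis (Fin 3) ℝ E3) : E3 ≃ᵢ E3 :=
  w.repr.symm.toIsometryEquiv.trans (IsometryEquiv.addLeft a)

theorem frameIsometry_apply (a : E3) (w : OrthonormalBasis (Fin 3) ℝ E3) (x y z : ℝ) :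
    frameIsometry a w !₂[x, y, z] = a + (x • w 0 + y • w 1 + z • w 2) := by
  have : w.repr.symm !₂[x, y, z] = x • w 0 + y • w 1 + z • w 2 := by
    rw [← w.sum_repr_symm, Fin.sum_univ_three]
    simp
  rw [← this]
  rfl

theorem map_frameIsometry_symm {a : E3} {w : OrthonormalBasis (Fin 3) ℝ E3} {x y z : ℝ} {m : M3}
    (hm : m = ((a + (x • w 0 + y • w 1 + z • w 2) : E3) : M3)) :
    OnePoint.map (frameIsometry a w).symm m = ((!₂[x, y, z] : E3) : M3) := by
  rw [hm, ← frameIsometry_apply, OnePoint.map_some, IsometryEquiv.symm_apply_apply]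

section Lines

variable {p q : I → M3} {a₁ a₂ d₁ d₂ : E3} {s t l : ℝ}

theorem hasPatch_of_lines_of_pos (hp : IsCircularArc p) (hq : IsCircularArc q)
    (hp0 : p 0 = ∞) (hq0 : q 0 = ∞) (hd₁ : ‖d₁‖ = 1) (hd₂ : ‖d₂‖ = 1) (hd : inner ℝ d₁ d₂ = 0)
    (ha₁ : inner ℝ d₁ (a₂ - a₁) = 0) (ha₂ : inner ℝ d₂ (a₂ - a₁) = 0)
    (hpl : ∀ u ≠ 0, ∃ s : ℝ, p u = ((a₁ + s • d₁ : E3) : M3))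
    (hql : ∀ v ≠ 0, ∃ t : ℝ, q v = ((a₂ + t • d₂ : E3) : M3))
    (hpq : ¬ ∃ S, IsCircle S ∧ (∀ u, p u ∈ S) ∧ ∀ v, q v ∈ S)
    (hp1 : p 1 = ((a₁ + s • d₁ : E3) : M3)) (hq1 : q 1 = ((a₂ + t • d₂ : E3) : M3))
    (hm : 0 < l * (s ^ 2 + t ^ 2 + ‖a₂ - a₁‖ ^ 2) - s ^ 2) :
    HasPatch p q
      ((a₁ + s • d₁ + l • (a₂ + t • d₂ - (a₁ + s • d₁)) : E3) : M3) := by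
  obtain ⟨w, rfl, rfl⟩ := exists_orthonormalBasis_of_orthogonal_units hd₁ hd₂ hd
  obtain ⟨⟨h01, h02, h10⟩, h12, h20, h21⟩ := orthonormalBasis_inner_eq_zero w
  set b := -inner ℝ (w 0) (a₂ - a₁) with hb
  have hab : a₂ - a₁ = (-b) • w 0 := by
    apply eq_of_orthonormalBasis_inner_eq w <;> rw [inner_smul_right]
    · rw [orthonormalBasis_inner_self, hb]
      ring
    · rw [h10, ha₁, mul_zero]
    · rw [h20, ha₂, mul_zero]
  have ha : a₂ = a₁ + (-b) • w 0 := by rw [← hab]; abel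
  have hn : ‖a₂ - a₁‖ ^ 2 = b ^ 2 := by
    rw [hab, norm_smul, w.orthonormal.1, mul_one, norm_neg, Real.norm_eq_abs, sq_abs]
  rw [hn] at hm
  have hψ := isMoebius_map_isometry (frameIsometry a₁ w).symm
  refine HasPatch.of_map hψ ?_
  have key := hasPatch_of_pos (hp.comp hψ) (hq.comp hψ) (by rw [hp0, OnePoint.map_infty])
    (by rw [hq0, OnePoint.map_infty]) (b := b) (s := s) (t := t) (l := l) (fun u hu => ?_)
    (fun v hv => ?_) (not_onCircle_comp hpq hψ) (map_frameIsometry_symm ?_)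
    (map_frameIsometry_symm ?_) hm
  · rw [map_frameIsometry_symm (x := -(l * b)) (y := (1 - l) * s) (z := l * t)]
    · exact key
    · rw [ha, OnePoint.coe_eq_coe]
      module
  · obtain ⟨s, hs⟩ := hpl u hu
    exact ⟨s, map_frameIsometry_symm (by rw [hs, OnePoint.coe_eq_coe]; module)⟩
  · obtain ⟨t, ht⟩ := hql v hv
    exact ⟨t, map_frameIsometry_symm (by rw [ht, ha, OnePoint.coe_eq_coe]; module)⟩
  · rw [hp1, OnePoint.coe_eq_coe]
    module
  · rw [hq1, ha, OnePoint.coe_eq_coe]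
    module

theorem hasPatch_of_lines_of_foot (hp : IsCircularArc p) (hq : IsCircularArc q)
    (hp0 : p 0 = ∞) (hq0 : q 0 = ∞) (hd₁ : ‖d₁‖ = 1) (hd₂ : ‖d₂‖ = 1) (hd : inner ℝ d₁ d₂ = 0)
    (hpl : ∀ u ≠ 0, ∃ s : ℝ, p u = ((a₁ + s • d₁ : E3) : M3))
    (hql : ∀ v ≠ 0, ∃ t : ℝ, q v = ((a₁ + t • d₂ : E3) : M3))
    (hpq : ¬ ∃ S, IsCircle S ∧ (∀ u, p u ∈ S) ∧ ∀ v, q v ∈ S)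
    (hp1 : p 1 = ((a₁ + s • d₁ : E3) : M3)) (hq1 : q 1 = ((a₁ + t • d₂ : E3) : M3))
    (hs : s ≠ 0) (ht : t ≠ 0) (hm : l * (s ^ 2 + t ^ 2) = s ^ 2) :
    HasPatch p q
      ((a₁ + s • d₁ + l • (a₁ + t • d₂ - (a₁ + s • d₁)) : E3) : M3) := by
  obtain ⟨w', h1, h2⟩ := exists_orthonormalBasis_of_orthogonal_units hd₁ hd₂ hd
  obtain ⟨w, rfl, rfl⟩ : ∃ w : OrthonormalBasis (Fin 3) ℝ E3, w 0 = d₁ ∧ w 1 = d₂ :=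
    ⟨w'.reindex (finRotate 3).symm, by simpa using h1, by simpa using h2⟩
  have hψ := isMoebius_map_isometry (frameIsometry a₁ w).symm
  refine HasPatch.of_map hψ ?_
  have key := hasPatch_of_foot (hp.comp hψ) (hq.comp hψ) (by rw [hp0, OnePoint.map_infty])
    (by rw [hq0, OnePoint.map_infty]) (s := s) (t := t) (l := l) (fun u hu => ?_)
    (fun v hv => ?_) (not_onCircle_comp hpq hψ) (map_frameIsometry_symm ?_)
    (map_frameIsometry_symm ?_) hs ht hm
  · rw [map_frameIsometry_symm (x := (1 - l) * s) (y := l * t) (z := 0)]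
    · exact key
    · rw [OnePoint.coe_eq_coe]
      module
  · obtain ⟨s, hs⟩ := hpl u hu
    exact ⟨s, map_frameIsometry_symm (by rw [hs, OnePoint.coe_eq_coe]; module)⟩
  · obtain ⟨t, ht⟩ := hql v hv
    exact ⟨t, map_frameIsometry_symm (by rw [ht, OnePoint.coe_eq_coe]; module)⟩
  · rw [hp1, OnePoint.coe_eq_coe]
    module
  · rw [hq1, OnePoint.coe_eq_coe]
    module

/-- Existence for boundary arcs on orthogonal lines, whose common perpendicular joins `a₁` and
`a₂`. If `X` divides the segment from `P` to `Q` in the ratio `l : 1 - l`, the patch is a surface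
of revolution in one of the two parameter directions when `‖P - a₁‖² < l ‖Q - P‖²` or
`‖Q - a₂‖² < (1 - l) ‖Q - P‖²`. Since `‖Q - P‖² = ‖P - a₁‖² + ‖Q - a₂‖² + ‖a₂ - a₁‖²`, both fail
only if `a₁ = a₂` and `X` is the foot of the perpendicular from there. -/
theorem hasPatch_of_lines (hp : IsCircularArc p) (hq : IsCircularArc q)
    (hp0 : p 0 = ∞) (hq0 : q 0 = ∞) (hd₁ : ‖d₁‖ = 1) (hd₂ : ‖d₂‖ = 1) (hd : inner ℝ d₁ d₂ = 0)
    (ha₁ : inner ℝ d₁ (a₂ - a₁) = 0) (ha₂ : inner ℝ d₂ (a₂ - a₁) = 0)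
    (hpl : ∀ u ≠ 0, ∃ s : ℝ, p u = ((a₁ + s • d₁ : E3) : M3))
    (hql : ∀ v ≠ 0, ∃ t : ℝ, q v = ((a₂ + t • d₂ : E3) : M3))
    (hpq : ¬ ∃ S, IsCircle S ∧ (∀ u, p u ∈ S) ∧ ∀ v, q v ∈ S)
    (hp1 : p 1 = ((a₁ + s • d₁ : E3) : M3)) (hq1 : q 1 = ((a₂ + t • d₂ : E3) : M3))
    (hne : p 1 ≠ q 1) (hl0 : l ≠ 0) (hl1 : l ≠ 1) :
    HasPatch p q
      ((a₁ + s • d₁ + l • (a₂ + t • d₂ - (a₁ + s • d₁)) : E3) : M3) := by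
  by_cases hm : 0 < l * (s ^ 2 + t ^ 2 + ‖a₂ - a₁‖ ^ 2) - s ^ 2
  · exact hasPatch_of_lines_of_pos hp hq hp0 hq0 hd₁ hd₂ hd ha₁ ha₂ hpl hql hpq hp1 hq1 hm
  by_cases hm' : 0 < (1 - l) * (t ^ 2 + s ^ 2 + ‖a₁ - a₂‖ ^ 2) - t ^ 2
  · have := hasPatch_of_lines_of_pos hq hp hq0 hp0 hd₂ hd₁ (by rw [real_inner_comm, hd])
      (by rw [← neg_sub, inner_neg_right, ha₂, neg_zero])
      (by rw [← neg_sub, inner_neg_right, ha₁, neg_zero]) hql hpl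
      (fun ⟨S, hS, h1, h2⟩ => hpq ⟨S, hS, h2, h1⟩) hq1 hp1 hm'
    convert this.swap using 2
    module
  rw [norm_sub_rev] at hm'
  have h0 : ‖a₂ - a₁‖ = 0 := by nlinarith [norm_nonneg (a₂ - a₁)]
  obtain rfl : a₂ = a₁ := sub_eq_zero.1 (norm_eq_zero.1 h0)
  simp only [sub_self, norm_zero] at hm hm'
  have hl : l * (s ^ 2 + t ^ 2) = s ^ 2 := by linarith
  refine hasPatch_of_lines_of_foot hp hq hp0 hq0 hd₁ hd₂ hd hpl hql hpq hp1 hq1 ?_ ?_ hl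
  · rintro rfl
    have ht : t = 0 := by simpa [hl0] using hl
    exact hne (by rw [hp1, hq1, ht, zero_smul, zero_smul])
  · rintro rfl
    have hs : s = 0 := by
      have : (l - 1) * s ^ 2 = 0 := by linear_combination hl
      simpa [sub_ne_zero.2 hl1] using this
    exact hne (by rw [hp1, hq1, hs, zero_smul, zero_smul])

end Lines

theorem exists_direction {C : Set M3} (hC : IsCircle C) (h : ∞ ∈ C) :
    ∃ a d : E3, ‖d‖ = 1 ∧ ∀ y : E3, (y : M3) ∈ C → ∃ s : ℝ, y = a + s • d := by
  obtain ⟨a, b, hab, rfl⟩ := hC.eq_line h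
  have hn : ‖b - a‖ ≠ 0 := norm_ne_zero_iff.2 (sub_ne_zero.2 hab.symm)
  refine ⟨a, ‖b - a‖⁻¹ • (b - a), by rw [norm_smul, norm_inv, norm_norm, inv_mul_cancel₀ hn],
    fun y hy => ?_⟩
  obtain ⟨s, rfl⟩ := mem_affineSpan_pair_iff.1 (coe_mem_line_iff.1 hy)
  exact ⟨s * ‖b - a‖, by rw [smul_smul, mul_assoc, mul_inv_cancel₀ hn, mul_one]⟩

theorem exists_smul_eq_of_two_points {p : I → M3} (hp : Function.Injective p) {a d a' d' : E3}
    (h : ∀ u ≠ 0, ∃ s : ℝ, p u = ((a + s • d : E3) : M3))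
    (h' : ∀ u ≠ 0, ∃ s : ℝ, p u = ((a' + s • d' : E3) : M3)) : ∃ c : ℝ, d = c • d' := by
  obtain ⟨u, hu0, hu1⟩ : ∃ u : I, u ≠ 0 ∧ u ≠ 1 :=
    ⟨⟨1 / 2, by norm_num, by norm_num⟩, by simp [← Subtype.coe_inj], by
      simp [← Subtype.coe_inj]⟩
  obtain ⟨s, hs⟩ := h u hu0
  obtain ⟨t, ht⟩ := h 1 one_ne_zero
  obtain ⟨s', hs'⟩ := h' u hu0
  obtain ⟨t', ht'⟩ := h' 1 one_ne_zero
  have hst : s - t ≠ 0 := by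
    intro hst
    rw [sub_eq_zero.1 hst] at hs
    exact hu1 (hp (hs.trans ht.symm))
  have e1 : a + s • d = a' + s' • d' := OnePoint.coe_injective (hs.symm.trans hs')
  have e2 : a + t • d = a' + t' • d' := OnePoint.coe_injective (ht.symm.trans ht')
  have e3 : (s - t) • d = (s' - t') • d' := by
    have : (s - t) • d = (a + s • d) - (a + t • d) := by module
    rw [this, e1, e2]
    module
  exact ⟨(s - t)⁻¹ * (s' - t'), by rw [mul_smul, ← e3, smul_smul, inv_mul_cancel₀ hst, one_smul]⟩

theorem not_onCircle_of_orthogonal {p q : I → M3} (hp : Function.Injective p)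
    (hq : Function.Injective q) (hp0 : p 0 = ∞) {a₁ a₂ d₁ d₂ : E3}
    (hd₁ : ‖d₁‖ = 1) (hd₂ : ‖d₂‖ = 1) (hd : inner ℝ d₁ d₂ = 0)
    (hpl : ∀ u ≠ 0, ∃ s : ℝ, p u = ((a₁ + s • d₁ : E3) : M3))
    (hql : ∀ v ≠ 0, ∃ t : ℝ, q v = ((a₂ + t • d₂ : E3) : M3)) :
    ¬ ∃ S, IsCircle S ∧ (∀ u, p u ∈ S) ∧ ∀ v, q v ∈ S := by
  rintro ⟨S, hS, hpS, hqS⟩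
  obtain ⟨a, d, hdn, hline⟩ := exists_direction hS (hp0 ▸ hpS 0)
  have key : ∀ {k : I → M3} {a' d' : E3}, Function.Injective k → (∀ u, k u ∈ S) →
      (∀ u ≠ 0, ∃ s : ℝ, k u = ((a' + s • d' : E3) : M3)) → ∃ c : ℝ, d' = c • d := by
    intro k a' d' hk hkS hkl
    refine exists_smul_eq_of_two_points (a' := a) hk hkl fun u hu => ?_
    obtain ⟨s, hs⟩ := hkl u hu
    obtain ⟨s', hs'⟩ := hline _ (hs ▸ hkS u)
    exact ⟨s', hs.trans (congrArg _ hs')⟩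
  obtain ⟨c, rfl⟩ := key hp hpS hpl
  obtain ⟨c', rfl⟩ := key hq hqS hql
  rw [inner_smul_left, inner_smul_right, real_inner_self_eq_norm_sq, hdn] at hd
  rw [norm_smul, hdn] at hd₁ hd₂
  rcases (by simpa using hd : c = 0 ∨ c' = 0) with rfl | rfl
  · simp at hd₁
  · simp at hd₂

/-- The inversion scales the chords from `p 0` by `‖p u - p 0‖⁻²`. So if the inverted arc lies on a
line, the component of the normalized chord along any `w` orthogonal to that line is a constant
times `‖p u - p 0‖`, and vanishes in the limit. -/
theorem exists_smul_eq_of_hasInitialDirection {p : I → E3} (hp : Continuous p)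
    (hinj : Function.Injective p) {t a d : E3} (ht : HasInitialDirection p t) (hd : ‖d‖ = 1)
    (hl : ∀ u ≠ 0, ∃ s : ℝ, sphereInversion (p 0) 1 (p u) = ((a + s • d : E3) : M3)) :
    ∃ c : ℝ, c ≠ 0 ∧ t = c • d := by
  have hpne : ∀ {u}, u ≠ 0 → ‖p u - p 0‖ ≠ 0 := fun hu =>
    norm_ne_zero_iff.2 (sub_ne_zero.2 (hinj.ne hu))
  have horth : ∀ w : E3, inner ℝ w d = 0 → inner ℝ w t = 0 := by
    intro w hw
    have h1 : Tendsto (fun u : I => inner ℝ w (‖p u - p 0‖⁻¹ • (p u - p 0))) (𝓝[≠] 0)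
        (𝓝 (inner ℝ w t)) := tendsto_const_nhds.inner ht
    have h2 : Tendsto (fun u : I => ‖p u - p 0‖ * inner ℝ w (a - p 0)) (𝓝[≠] 0) (𝓝 0) := by
      have : Continuous fun u : I => ‖p u - p 0‖ * inner ℝ w (a - p 0) := by fun_prop
      have := this.tendsto 0
      simp only [sub_self, norm_zero, zero_mul] at this
      exact this.mono_left nhdsWithin_le_nhds
    refine tendsto_nhds_unique (h1.congr' ?_) h2
    filter_upwards [self_mem_nhdsWithin] with u hu
    obtain ⟨s, hs⟩ := hl u hu
    rw [sphereInversion_coe 1 (hinj.ne hu), OnePoint.coe_eq_coe] at hs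
    have e : (1 / ‖p u - p 0‖) ^ 2 • (p u - p 0) = (a - p 0) + s • d := by
      have : EuclideanGeometry.inversion (p 0) 1 (p u) - p 0 =
          (1 / ‖p u - p 0‖) ^ 2 • (p u - p 0) := by
        simp [EuclideanGeometry.inversion, dist_eq_norm]
      rw [← this, hs]
      abel
    have e' := congrArg (fun x => ‖p u - p 0‖ * inner ℝ w x) e
    simp only [inner_add_right, inner_smul_right, hw, mul_zero, add_zero] at e'
    rw [inner_smul_right, ← e']
    have := hpne hu
    field_simp
  have hnorm : ‖t‖ = 1 := by
    have h1 : Tendsto (fun u : I => ‖‖p u - p 0‖⁻¹ • (p u - p 0)‖) (𝓝[≠] 0) (𝓝 ‖t‖) := ht.norm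
    refine tendsto_nhds_unique (h1.congr' ?_) tendsto_const_nhds
    filter_upwards [self_mem_nhdsWithin] with u hu
    rw [norm_smul, norm_inv, norm_norm, inv_mul_cancel₀ (hpne hu)]
  have hw : inner ℝ (t - inner ℝ t d • d) d = 0 := by
    rw [inner_sub_left, inner_smul_left, real_inner_self_eq_norm_sq, hd]
    simp
  have hz : t - inner ℝ t d • d = 0 := by
    rw [← inner_self_eq_zero (𝕜 := ℝ), inner_sub_right, inner_smul_right, hw, horth _ hw]
    simp
  refine ⟨inner ℝ t d, fun h => ?_, sub_eq_zero.1 hz⟩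
  rw [h, zero_smul, sub_zero] at hz
  simp [hz] at hnorm

/-! ### Passage from the given quadrilateral to lines -/

/-- After inversion at its initial point, a circular arc runs on a line that is parallel to the
initial direction of the arc. -/
theorem IsCircularArc.exists_line {p : I → E3} (hp : IsCircularArc fun u => (p u : M3)) {t : E3}
    (ht : HasInitialDirection p t) :
    ∃ a d : E3, ‖d‖ = 1 ∧ (∃ c : ℝ, c ≠ 0 ∧ t = c • d) ∧
      ∀ u ≠ 0, ∃ s : ℝ, sphereInversion (p 0) 1 (p u) = ((a + s • d : E3) : M3) := by
  have hc : Continuous p := OnePoint.isOpenEmbedding_coe.isInducing.continuous_iff.2 hp.1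
  have hi : Function.Injective p := fun u v h => hp.2.1 (congrArg _ h)
  obtain ⟨S, hS, hr⟩ := hp.2.2
  have hpS : ∀ u, (p u : M3) ∈ S := fun u => hr ⟨u, rfl⟩
  obtain ⟨a, d, hd, hl⟩ := exists_direction (hS.image_sphereInversion (p 0) one_pos)
    ⟨_, hpS 0, sphereInversion_center _ _⟩
  have hline : ∀ u ≠ 0, ∃ s : ℝ, sphereInversion (p 0) 1 (p u) = ((a + s • d : E3) : M3) := by
    intro u hu
    have hm : sphereInversion (p 0) 1 (p u) ∈ sphereInversion (p 0) 1 '' S := ⟨_, hpS u, rfl⟩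
    rw [sphereInversion_coe 1 (hi.ne hu)] at hm ⊢
    obtain ⟨s, hs⟩ := hl _ hm
    exact ⟨s, congrArg _ hs⟩
  exact ⟨a, d, hd, exists_smul_eq_of_hasInitialDirection hc hi ht hd hline, hline⟩

/-- Two orthogonal lines can be parametrized starting from the feet of a common perpendicular. -/
theorem exists_common_perpendicular (a₁ a₂ : E3) {d₁ d₂ : E3} (hd₁ : ‖d₁‖ = 1) (hd₂ : ‖d₂‖ = 1)
    (hd : inner ℝ d₁ d₂ = 0) :
    ∃ s t : ℝ, inner ℝ d₁ (a₂ + t • d₂ - (a₁ + s • d₁)) = 0 ∧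
      inner ℝ d₂ (a₂ + t • d₂ - (a₁ + s • d₁)) = 0 := by
  refine ⟨inner ℝ d₁ (a₂ - a₁), -inner ℝ d₂ (a₂ - a₁), ?_, ?_⟩
  · simp only [inner_add_right, inner_sub_right, inner_smul_right, hd, real_inner_self_eq_norm_sq,
      hd₁]
    ring
  · simp only [inner_add_right, inner_sub_right, inner_smul_right, real_inner_comm d₁ d₂, hd,
      real_inner_self_eq_norm_sq, hd₂]
    ring

/-- Existence of the patch; moreover, orthogonal arcs do not lie on a common circle. -/
theorem hasPatch_of_meetOrthogonally {x00 x10 x11 x01 : E3} (hx : IsCircularQuad x00 x10 x11 x01)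
    {p q : I → E3} (hp : IsCircularArc fun u => (p u : M3))
    (hq : IsCircularArc fun v => (q v : M3)) (hp0 : p 0 = x00) (hp1 : p 1 = x10)
    (hq0 : q 0 = x00) (hq1 : q 1 = x01) (hpq : MeetOrthogonally p q) :
    (¬ ∃ S, IsCircle S ∧ (∀ u, (p u : M3) ∈ S) ∧ ∀ v, (q v : M3) ∈ S) ∧
      HasPatch (fun u => (p u : M3)) (fun v => (q v : M3)) x11 := by
  obtain ⟨hnd, hcirc⟩ := hx
  simp only [List.nodup_cons, List.mem_cons, List.not_mem_nil, or_false, not_or,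
    List.nodup_nil, not_false_eq_true, and_true] at hnd
  obtain ⟨⟨h1, h2, h3⟩, ⟨h4, h5⟩, h6⟩ := hnd
  obtain ⟨-, τ₁, τ₂, hτ₁, hτ₂, hτ⟩ := hpq
  obtain ⟨a₁, d₁, hd₁, ⟨c₁, hc₁, rfl⟩, hpl⟩ := hp.exists_line hτ₁
  obtain ⟨a₂, d₂, hd₂, ⟨c₂, hc₂, rfl⟩, hql⟩ := hq.exists_line hτ₂
  have hd : inner ℝ d₁ d₂ = 0 := by
    rw [inner_smul_left, inner_smul_right] at hτ
    simpa [hc₁, hc₂] using hτ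
  rw [hp0] at hpl
  rw [hq0] at hql
  have hg := isMoebius_sphereInversion x00 one_pos
  obtain ⟨s₀, t₀, ha₁, ha₂⟩ := exists_common_perpendicular a₁ a₂ hd₁ hd₂ hd
  have hpl' : ∀ u ≠ 0, ∃ s : ℝ, sphereInversion x00 1 (p u) =
      ((a₁ + s₀ • d₁ + s • d₁ : E3) : M3) := fun u hu => by
    obtain ⟨s, hs⟩ := hpl u hu
    exact ⟨s - s₀, by rw [hs, OnePoint.coe_eq_coe]; module⟩
  have hql' : ∀ v ≠ 0, ∃ t : ℝ, sphereInversion x00 1 (q v) =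
      ((a₂ + t₀ • d₂ + t • d₂ : E3) : M3) := fun v hv => by
    obtain ⟨t, ht⟩ := hql v hv
    exact ⟨t - t₀, by rw [ht, OnePoint.coe_eq_coe]; module⟩
  have hgp := hp.comp hg
  have hgq := hq.comp hg
  have hgp0 : sphereInversion x00 1 (p 0) = ∞ := by rw [hp0, sphereInversion_center]
  have hgq0 : sphereInversion x00 1 (q 0) = ∞ := by rw [hq0, sphereInversion_center]
  have hncirc := not_onCircle_of_orthogonal hgp.2.1 hgq.2.1 hgp0 hd₁ hd₂ hd hpl' hql'
  refine ⟨fun ⟨S, hS, hS1, hS2⟩ => hncirc ⟨_, hS.image hg, fun u => ⟨_, hS1 u, rfl⟩,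
    fun v => ⟨_, hS2 v, rfl⟩⟩, HasPatch.of_map hg ?_⟩
  obtain ⟨s, hs⟩ := hpl' 1 one_ne_zero
  obtain ⟨t, ht⟩ := hql' 1 one_ne_zero
  have hPQ : a₁ + s₀ • d₁ + s • d₁ ≠ a₂ + t₀ • d₂ + t • d₂ := by
    intro h
    rw [h, ← ht] at hs
    apply h5
    have := hg.injective hs
    rwa [hp1, hq1, OnePoint.coe_eq_coe] at this
  obtain ⟨l, hl⟩ : ∃ l : ℝ, sphereInversion x00 1 x11 = ((a₁ + s₀ • d₁ + s • d₁ +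
      l • (a₂ + t₀ • d₂ + t • d₂ - (a₁ + s₀ • d₁ + s • d₁)) : E3) : M3) := by
    obtain ⟨S, hS, k0, k1, k2, k3⟩ := hcirc.map hg
    rw [← hp1, hs] at k1
    rw [← hq1, ht] at k3
    rw [sphereInversion_center] at k0
    rw [hS.eq_line_of_mem k0 k1 k3 hPQ] at k2
    rw [sphereInversion_coe 1 (Ne.symm h2)] at k2 ⊢
    obtain ⟨l, hl⟩ := mem_affineSpan_pair_iff.1 (coe_mem_line_iff.1 k2)
    exact ⟨l, congrArg _ hl⟩
  have key := hasPatch_of_lines (l := l) hgp hgq hgp0 hgq0 hd₁ hd₂ hd ha₁ ha₂ hpl' hql' hncirc hs ht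
    ?_ ?_ ?_
  · rw [hl]
    exact key
  · rw [hs, ht]
    exact fun h => hPQ (OnePoint.coe_injective h)
  · rintro rfl
    rw [zero_smul, add_zero, ← hs, hp1] at hl
    exact h4 (OnePoint.coe_injective (hg.injective hl)).symm
  · rintro rfl
    rw [one_smul, add_sub_cancel, ← ht, hq1] at hl
    exact h6 (OnePoint.coe_injective (hg.injective hl))

end Cyclidic

end

theorem mainTheorem12 (x00 x10 x11 x01 : Cyclidic.E3)
    (hx : Cyclidic.IsCircularQuad x00 x10 x11 x01)
    (p q : I → Cyclidic.E3)
    (hp : Cyclidic.IsCircularArc (fun u => (p u : Cyclidic.M3)))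
    (hq : Cyclidic.IsCircularArc (fun v => (q v : Cyclidic.M3)))
    (hp0 : p 0 = x00) (hp1 : p 1 = x10) (hq0 : q 0 = x00) (hq1 : q 1 = x01)
    (hpq : Cyclidic.MeetOrthogonally p q) :
    ∃! f : I × I → Cyclidic.M3,
      Cyclidic.IsDupinCyclidePatch f ∧ Cyclidic.IsAdapted f x00 x10 x11 x01 ∧
      (∀ u : I, f (u, 0) = (p u : Cyclidic.M3)) ∧
      (∀ v : I, f (0, v) = (q v : Cyclidic.M3)) := by
  obtain ⟨hncirc, f, hf, hfp, hfq, hf11⟩ :=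
    Cyclidic.hasPatch_of_meetOrthogonally hx hp hq hp0 hp1 hq0 hq1 hpq
  replace hfp : ∀ u, f (u, 0) = (p u : Cyclidic.M3) := hfp
  replace hfq : ∀ v, f (0, v) = (q v : Cyclidic.M3) := hfq
  refine ⟨f, ⟨hf, ⟨?_, ?_, hf11, ?_⟩, hfp, hfq⟩, ?_⟩
  · rw [hfp, hp0]
  · rw [hfp, hp1]
  · rw [hfq, hq1]
  rintro g ⟨hg, ⟨-, -, hg11, -⟩, hgp, hgq⟩
  obtain ⟨hnd, -⟩ := hx
  simp only [List.nodup_cons, List.mem_cons, List.not_mem_nil, or_false, not_or,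
    List.nodup_nil, not_false_eq_true, and_true] at hnd
  obtain ⟨⟨h1, h2, h3⟩, ⟨h4, h5⟩, h6⟩ := hnd
  have hι := Cyclidic.isMoebius_sphereInversion x00 one_pos
  have hne : ∀ {x y : Cyclidic.E3}, x ≠ y → Cyclidic.sphereInversion x00 1 x ≠
      Cyclidic.sphereInversion x00 1 y := fun h => hι.injective.ne (OnePoint.coe_injective.ne h)
  have key := (hg.comp hι).eq_of_boundary_eq (hf.comp hι) ?_ (fun u => ?_) (fun v => ?_) ?_ ?_ ?_ ?_
    ?_ ?_ ?_ ?_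
  · exact hι.injective.comp_left key
  all_goals simp only [Function.comp_apply, hgp, hgq, hfp, hfq, hg11, hf11, hp0, hp1, hq1]
  · exact Cyclidic.sphereInversion_center x00 1
  · exact hp.comp hι
  · exact hq.comp hι
  · exact Cyclidic.not_onCircle_comp hncirc hι
  · rw [← Cyclidic.sphereInversion_center x00 1]
    exact hne (Ne.symm h2)
  · exact hne (Ne.symm h4)
  · exact hne h6
  · exact hne h5
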